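/- Let $n\in\mathbb N$, let $\Omega\subset\mathbb R^n$ be open, and let $\theta_1,\theta_2\in L^1(\Omega)$ satisfy $\theta_1,\theta_2\ge c$ a.e. in $\Omega$ for some constant $c>0$ (so that $\Omega$ has finite Lebesgue measure). For $u\in L^1(\Omega)$ let $$|{\rm D}u|(\Omega)=\sup\Big\{\int_\Omega u\,\operatorname{div}\varphi\,dx : \varphi\in C^1_c(\Omega,\mathbb R^n),\ |\varphi|\le 1\Big\}\in[0,\infty],$$ let $BV(\Omega)=\{u\in L^1(\Omega): |{\rm D}u|(\Omega)<\infty\}$, and let $BV(\Omega,\{0,1\})$ be the set of all $\chi\in BV(\Omega)$ with $\chi\in\{0,1\}$ a.e. in $\Omega$. Consider the relaxed energy $$E^{rel}[u]=\int_\Omega u^2\theta_1+(1-u)^2\theta_2\,dx+|{\rm D}u|(\Omega)\in[0,\infty],\qquad u\in BV(\Omega),$$ and the binary Mumford–Shah energy $$E[\chi]=\int_\Omega \theta_1\chi+\theta_2(1-\chi)\,dx+|{\rm D}\chi|(\Omega),\qquad \chi\in BV(\Omega,\{0,1\}).$$ Then $E^{rel}$ has a minimizer in $BV(\Omega)$.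 Moreover, every minimizer $u\in BV(\Omega)$ of $E^{rel}$ satisfies $0\le u\le 1$ a.e. in $\Omega$, and the indicator function $\chi_{[u>1/2]}$ of its superlevel set $[u>1/2]=\{x\in\Omega: u(x)>\tfrac12\}$ belongs to $BV(\Omega,\{0,1\})$ and minimizes $E$ over $BV(\Omega,\{0,1\})$. -/

import Mathlib

open MeasureTheory Set
open scoped ENNReal

noncomputable section

/-- The divergence of a vector field on Euclidean space, as the sum of the partial
derivatives of its components. -/
def vectorDiv {n : ℕ} (φ : EuclideanSpace ℝ (Fin n) → EuclideanSpace ℝ (Fin n))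
    (x : EuclideanSpace ℝ (Fin n)) : ℝ :=
  ∑ i, (fderiv ℝ φ x (EuclideanSpace.single i 1)) i

/-- The admissible test fields for the total variation: continuously differentiable fields with
compact support in `Ω` and with Euclidean norm at most one everywhere. -/
def tvTestFields {n : ℕ} (Ω : Set (EuclideanSpace ℝ (Fin n))) :
    Set (EuclideanSpace ℝ (Fin n) → EuclideanSpace ℝ (Fin n)) :=
  {φ | ContDiff ℝ 1 φ ∧ HasCompactSupport φ ∧ tsupport φ ⊆ Ω ∧ ∀ x, ‖φ x‖ ≤ 1}

/-- The total variation `|Du|(Ω)` of a function that is integrable on the open set `Ω`, with values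
in `[0, ∞]`. Since the set of test fields is invariant under `φ ↦ -φ`, cutting negative integrals
off at zero does not change the supremum. -/
def totalVariation {n : ℕ} (Ω : Set (EuclideanSpace ℝ (Fin n)))
    (u : EuclideanSpace ℝ (Fin n) → ℝ) : ℝ≥0∞ :=
  ⨆ φ ∈ tvTestFields Ω, ENNReal.ofReal (∫ x in Ω, u x * vectorDiv φ x)

/-- The space `BV(Ω)`: integrable functions on `Ω` with finite total variation in `Ω`.
Functions are represented by functions on the whole space; the values outside `Ω` and on
null sets play no role. -/
def BV {n : ℕ} (Ω : Set (EuclideanSpace ℝ (Fin n))) : Set (EuclideanSpace ℝ (Fin n) → ℝ) :=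
  {u | IntegrableOn u Ω ∧ totalVariation Ω u < ⊤}

/-- The set `BV(Ω, {0,1})` of functions in `BV(Ω)` with values in `{0,1}` a.e. in `Ω`. -/
def BVBinary {n : ℕ} (Ω : Set (EuclideanSpace ℝ (Fin n))) :
    Set (EuclideanSpace ℝ (Fin n) → ℝ) :=
  {χ | χ ∈ BV Ω ∧ ∀ᵐ x ∂(volume.restrict Ω), χ x = 0 ∨ χ x = 1}

/-- The binary Mumford-Shah energy
`E[χ] = ∫_Ω θ₁ χ + θ₂ (1 - χ) dx + |Dχ|(Ω)`.
For `θ₁, θ₂ ≥ 0` and `χ` with values in `{0,1}` the integrand is nonnegative. -/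
def binaryEnergy {n : ℕ} (Ω : Set (EuclideanSpace ℝ (Fin n)))
    (θ₁ θ₂ : EuclideanSpace ℝ (Fin n) → ℝ) (χ : EuclideanSpace ℝ (Fin n) → ℝ) : ℝ≥0∞ :=
  (∫⁻ x in Ω, ENNReal.ofReal (θ₁ x * χ x + θ₂ x * (1 - χ x))) + totalVariation Ω χ

/-- The relaxed energy
`E^rel[u] = ∫_Ω u² θ₁ + (1 - u)² θ₂ dx + |Du|(Ω)`,
which is `∞` where the data term is not integrable.
For `θ₁, θ₂ ≥ 0` the integrand is nonnegative. -/
def relaxedEnergy {n : ℕ} (Ω : Set (EuclideanSpace ℝ (Fin n)))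
    (θ₁ θ₂ : EuclideanSpace ℝ (Fin n) → ℝ) (u : EuclideanSpace ℝ (Fin n) → ℝ) : ℝ≥0∞ :=
  (∫⁻ x in Ω, ENNReal.ofReal (u x ^ 2 * θ₁ x + (1 - u x) ^ 2 * θ₂ x)) + totalVariation Ω u

/-- The indicator function of the superlevel set `[u > s] = {x ∈ Ω : u x > s}`. -/
def superlevelIndicator {n : ℕ} (Ω : Set (EuclideanSpace ℝ (Fin n)))
    (u : EuclideanSpace ℝ (Fin n) → ℝ) (s : ℝ) : EuclideanSpace ℝ (Fin n) → ℝ :=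
  {x | x ∈ Ω ∧ s < u x}.indicator (fun _ => 1)

end

/-!
The heart of the matter is that cutting a function at a level `s` splits its total variation:
`|D min(u, s)| + |D (u - s)⁺| ≤ |Du|` (`totalVariation_min_add_le`). This replaces the coarea
formula, and it is proved by duality. For smooth `w` and smooth `f`, `h` with `|f'| + |h'| ≤ 1`,
testing `f ∘ w` with `φ` and `h ∘ w` with `ψ` is the same as testing `w` with the single
admissible field `f'(w) φ + h'(w) ψ` (`integral_comp_mul_vectorDiv`). Taking for `w` a mollification
of `u`, moving the mollifier onto that field, and letting `f` and `h` approximate the positive and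
the negative part gives the claim at the level `0`, and translation gives it at every level.

Consequences. Truncation to `[0, 1]` does not increase the variation, whereas it strictly lowers
the data term where it acts, so minimizers lie in `[0, 1]` (`mem_Icc_of_isMinOn`). For existence,
the data term is quadratic and uniformly convex in `L²`, so that a truncated minimizing sequence
is Cauchy in `L²` and, if fast enough, converges almost everywhere; dominated convergence and lower
semicontinuity of the variation conclude (`exists_isMinOn_relaxedEnergy`).

For the superlevel set, let `g = 2 (1 - u) θ₂ - 2 u θ₁` be the negative derivative of the data term
at a minimizer `u`. First-order optimality and sublinearity of the variation give `∫ g v ≤ |Dv|` for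
all bounded `v`, with equality for `v = u` (`dual_bounds_of_isMinOn`). Splitting `u` at the levels
`s` and `s + ε` therefore forces equality for each of the three parts. The middle part divided by
`ε` converges to the indicator of `[u > s]`, which thus satisfies `|Dχ| ≤ ∫ g χ`
(`totalVariation_superlevelIndicator_le`). At `s = 1 / 2` the comparison of binary energies reduces
to the sign of `θ₁ - θ₂ + g = (1 - 2 u) (θ₁ + θ₂)` (`superlevelIndicator_isMinOn`).
-/

open Filter Topology

/-! ### The divergence of compactly supported fields -/

section Divergence

variable {n : ℕ}

/-- The trace of an endomorphism of Euclidean space, so that `vectorDiv φ x` is the trace of the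
derivative of `φ` at `x`. -/
noncomputable def traceCLM (n : ℕ) :
    (EuclideanSpace ℝ (Fin n) →L[ℝ] EuclideanSpace ℝ (Fin n)) →L[ℝ] ℝ :=
  ∑ i, (EuclideanSpace.proj i : EuclideanSpace ℝ (Fin n) →L[ℝ] ℝ) ∘L
    ContinuousLinearMap.apply ℝ (EuclideanSpace ℝ (Fin n)) (EuclideanSpace.single i 1)

lemma vectorDiv_eq_traceCLM (φ : EuclideanSpace ℝ (Fin n) → EuclideanSpace ℝ (Fin n))
    (x : EuclideanSpace ℝ (Fin n)) : vectorDiv φ x = traceCLM n (fderiv ℝ φ x) := by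
  simp [vectorDiv, traceCLM]

variable {φ ψ : EuclideanSpace ℝ (Fin n) → EuclideanSpace ℝ (Fin n)}

lemma continuous_vectorDiv (hφ : ContDiff ℝ 1 φ) : Continuous (vectorDiv φ) := by
  have : vectorDiv φ = fun x => traceCLM n (fderiv ℝ φ x) :=
    funext (vectorDiv_eq_traceCLM φ)
  rw [this]
  exact (traceCLM n).continuous.comp (hφ.continuous_fderiv one_ne_zero)

lemma hasCompactSupport_vectorDiv (hφ : HasCompactSupport φ) :
    HasCompactSupport (vectorDiv φ) := by
  have : vectorDiv φ = traceCLM n ∘ fderiv ℝ φ := funext (vectorDiv_eq_traceCLM φ)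
  rw [this]
  exact (hφ.fderiv (𝕜 := ℝ)).comp_left (map_zero _)

lemma vectorDiv_neg (φ : EuclideanSpace ℝ (Fin n) → EuclideanSpace ℝ (Fin n))
    (x : EuclideanSpace ℝ (Fin n)) : vectorDiv (fun y => -φ y) x = -vectorDiv φ x := by
  rw [vectorDiv_eq_traceCLM, vectorDiv_eq_traceCLM, fderiv_fun_neg, map_neg]

lemma vectorDiv_add (hφ : ContDiff ℝ 1 φ) (hψ : ContDiff ℝ 1 ψ)
    (x : EuclideanSpace ℝ (Fin n)) :
    vectorDiv (fun y => φ y + ψ y) x = vectorDiv φ x + vectorDiv ψ x := by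
  rw [vectorDiv_eq_traceCLM, vectorDiv_eq_traceCLM, vectorDiv_eq_traceCLM,
    fderiv_fun_add (hφ.differentiable one_ne_zero x) (hψ.differentiable one_ne_zero x), map_add]

lemma vectorDiv_smul {w : EuclideanSpace ℝ (Fin n) → ℝ} (hw : ContDiff ℝ 1 w)
    (hφ : ContDiff ℝ 1 φ) (x : EuclideanSpace ℝ (Fin n)) :
    vectorDiv (fun y => w y • φ y) x = w x * vectorDiv φ x + fderiv ℝ w x (φ x) := by
  rw [vectorDiv_eq_traceCLM, vectorDiv_eq_traceCLM,
    fderiv_fun_smul (hw.differentiable one_ne_zero x) (hφ.differentiable one_ne_zero x), map_add,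
    map_smul, smul_eq_mul]
  congr 1
  have h : φ x = ∑ i, φ x i • EuclideanSpace.single i (1 : ℝ) := by
    ext j
    simp [Finset.sum_apply, Pi.single_apply]
  conv_rhs => rw [h, map_sum]
  simp [traceCLM, mul_comm]

lemma integral_vectorDiv_eq_zero (hφ : ContDiff ℝ 1 φ) (hc : HasCompactSupport φ) :
    ∫ x, vectorDiv φ x = 0 := by
  have key : ∀ (i : Fin n) (v : EuclideanSpace ℝ (Fin n)),
      Integrable (fun x => fderiv ℝ φ x v i) ∧ ∫ x, fderiv ℝ φ x v i = 0 := by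
    intro i v
    have hd : ∀ x, fderiv ℝ (fun y => φ y i) x v = fderiv ℝ φ x v i := by
      intro x
      have := ((EuclideanSpace.proj i : EuclideanSpace ℝ (Fin n) →L[ℝ] ℝ).hasFDerivAt.comp x
        (hφ.differentiable one_ne_zero x).hasFDerivAt).fderiv
      have h2 := congrArg (fun A => A v) this
      simpa [Function.comp_def] using h2
    have hcont : Continuous (fun x => fderiv ℝ φ x v i) :=
      (EuclideanSpace.proj i : EuclideanSpace ℝ (Fin n) →L[ℝ] ℝ).continuous.comp
        ((hφ.continuous_fderiv one_ne_zero).clm_apply continuous_const)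
    have hsupp : HasCompactSupport (fun x => fderiv ℝ φ x v i) :=
      (hc.fderiv_apply (𝕜 := ℝ) v).comp_left (g := fun z : EuclideanSpace ℝ (Fin n) => z i) rfl
    have hint := hcont.integrable_of_hasCompactSupport (μ := volume) hsupp
    have hφi : Continuous (fun x => φ x i) :=
      (EuclideanSpace.proj i : EuclideanSpace ℝ (Fin n) →L[ℝ] ℝ).continuous.comp hφ.continuous
    have hsφ : HasCompactSupport (fun x => φ x i) :=
      hc.comp_left (g := fun z : EuclideanSpace ℝ (Fin n) => z i) rfl
    refine ⟨hint, ?_⟩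
    have := integral_mul_fderiv_eq_neg_fderiv_mul_of_integrable (μ := volume)
      (f := fun _ : EuclideanSpace ℝ (Fin n) => (1 : ℝ)) (g := fun x => φ x i) (v := v)
      (by simp) (by simpa [hd] using hint)
      (by simpa using hφi.integrable_of_hasCompactSupport hsφ)
      (fun x _ => differentiableAt_const _)
      (fun x _ => (EuclideanSpace.proj i : EuclideanSpace ℝ (Fin n) →L[ℝ] ℝ).differentiableAt.comp x
        (hφ.differentiable one_ne_zero x))
    simpa [hd] using this
  simp only [vectorDiv]
  rw [integral_finsetSum _ (fun i _ => (key i _).1)]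
  exact Finset.sum_eq_zero fun i _ => (key i _).2

/-- The chain rule in divergence form: `f ∘ w` tested against `φ` equals `w` tested against
`(f' ∘ w) φ`, because both are `-∫ f'(w) ∇w · φ`. -/
lemma integral_comp_mul_vectorDiv {w : EuclideanSpace ℝ (Fin n) → ℝ} (hw : ContDiff ℝ 1 w)
    {f : ℝ → ℝ} (hf : ContDiff ℝ 2 f) (hφ : ContDiff ℝ 1 φ) (hc : HasCompactSupport φ) :
    ∫ x, f (w x) * vectorDiv φ x = ∫ x, w x * vectorDiv (fun y => deriv f (w y) • φ y) x := by
  have ibp : ∀ {v : EuclideanSpace ℝ (Fin n) → ℝ}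
      {Φ : EuclideanSpace ℝ (Fin n) → EuclideanSpace ℝ (Fin n)}, ContDiff ℝ 1 v →
      ContDiff ℝ 1 Φ → HasCompactSupport Φ →
      ∫ x, v x * vectorDiv Φ x = -∫ x, fderiv ℝ v x (Φ x) := by
    intro v Φ hv hΦ hΦc
    have h0 := integral_vectorDiv_eq_zero (hv.smul hΦ) hΦc.smul_left
    have h1 : ∀ x, vectorDiv (v • Φ) x = v x * vectorDiv Φ x + fderiv ℝ v x (Φ x) :=
      vectorDiv_smul hv hΦ
    have i1 : Integrable (fun x => v x * vectorDiv Φ x) :=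
      (hv.continuous.mul (continuous_vectorDiv hΦ)).integrable_of_hasCompactSupport
        (hasCompactSupport_vectorDiv hΦc).mul_left
    have i2 : Integrable (fun x => fderiv ℝ v x (Φ x)) := by
      refine ((hv.continuous_fderiv one_ne_zero).clm_apply
        hΦ.continuous).integrable_of_hasCompactSupport ?_
      refine hΦc.mono fun x hx hx0 => hx ?_
      simp only [hx0, map_zero]
    simp only [h1] at h0
    rw [integral_add i1 i2] at h0
    linarith
  have hf' : ContDiff ℝ 1 (deriv f) := hf.deriv'
  refine (ibp ((hf.of_le one_le_two).comp hw) hφ hc).trans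
    (Eq.trans (congrArg Neg.neg ?_) (ibp hw ((hf'.comp hw).smul hφ) hc.smul_left).symm)
  refine integral_congr_ae (Eventually.of_forall fun x => ?_)
  have hfd : HasDerivAt f (deriv f (w x)) (w x) :=
    (hf.differentiable two_ne_zero (w x)).hasDerivAt
  have := (hfd.comp_hasFDerivAt x (hw.differentiable one_ne_zero x).hasFDerivAt).fderiv
  have h2 := congrArg (fun A => A (φ x)) this
  simpa [Function.comp_def] using h2

end Divergence

/-! ### Mollification of functions and of test fields -/

section Mollify

open scoped Convolution

variable {n : ℕ} {φ : EuclideanSpace ℝ (Fin n) → EuclideanSpace ℝ (Fin n)}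

lemma vectorDiv_convolution {ρ : EuclideanSpace ℝ (Fin n) → ℝ} (hρ : Continuous ρ)
    (hφ : ContDiff ℝ 1 φ) (hc : HasCompactSupport φ)
    (x : EuclideanSpace ℝ (Fin n)) :
    vectorDiv (ρ ⋆[ContinuousLinearMap.lsmul ℝ ℝ, volume] φ) x =
      ∫ t, ρ t * vectorDiv φ (x - t) := by
  have h := (hc.hasFDerivAt_convolution_right (ContinuousLinearMap.lsmul ℝ ℝ)
    (hρ.locallyIntegrable (μ := volume)) hφ x).fderiv
  have hex : ConvolutionExistsAt ρ (fderiv ℝ φ) x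
      ((ContinuousLinearMap.lsmul ℝ ℝ).precompR (EuclideanSpace ℝ (Fin n))) volume :=
    (hc.fderiv (𝕜 := ℝ)).convolutionExists_right _ hρ.locallyIntegrable
      (hφ.continuous_fderiv one_ne_zero) x
  rw [vectorDiv_eq_traceCLM, h, convolution_def, ← ContinuousLinearMap.integral_comp_comm _ hex]
  refine integral_congr_ae (Eventually.of_forall fun t => ?_)
  have : (ContinuousLinearMap.lsmul ℝ ℝ : ℝ →L[ℝ] EuclideanSpace ℝ (Fin n) →L[ℝ] _).precompR
      (EuclideanSpace ℝ (Fin n)) (ρ t) (fderiv ℝ φ (x - t)) = ρ t • fderiv ℝ φ (x - t) := by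
    ext v; simp [ContinuousLinearMap.precompR_apply]
  simp only [this, map_smul, smul_eq_mul, vectorDiv_eq_traceCLM]

/-- Convolution with an even kernel is symmetric for the `L²` pairing. -/
lemma integral_convolution_mul {ρ u k : EuclideanSpace ℝ (Fin n) → ℝ} (hρ : Continuous ρ)
    (hρc : HasCompactSupport ρ) (heven : ∀ x, ρ (-x) = ρ x) (hu : Integrable u)
    (hk : Continuous k) (hkc : HasCompactSupport k) :
    ∫ x, (ρ ⋆[ContinuousLinearMap.lsmul ℝ ℝ, volume] u) x * k x =
      ∫ x, u x * ∫ t, ρ t * k (x - t) := by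
  obtain ⟨C, hC⟩ := hkc.exists_bound_of_continuous hk
  have hint : Integrable (fun p : EuclideanSpace ℝ (Fin n) × EuclideanSpace ℝ (Fin n) =>
      ρ p.2 * u (p.1 - p.2) * k p.1) (volume.prod volume) := by
    refine Integrable.mul_bdd (c := C)
      (Integrable.convolution_integrand (ContinuousLinearMap.lsmul ℝ ℝ)
        (hρ.integrable_of_hasCompactSupport hρc) hu) ?_ ?_
    · exact (hk.comp continuous_fst).aestronglyMeasurable
    · exact Eventually.of_forall fun p => hC p.1
  have hint2 : Integrable (fun p : EuclideanSpace ℝ (Fin n) × EuclideanSpace ℝ (Fin n) =>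
      u p.1 * (ρ p.2 * k (p.1 - p.2))) (volume.prod volume) := by
    have := Integrable.mul_prod hu (hρ.integrable_of_hasCompactSupport (μ := volume) hρc)
    refine (Integrable.mul_bdd (c := C) this (g := fun p => k (p.1 - p.2)) ?_ ?_).congr ?_
    · exact (hk.comp (continuous_fst.sub continuous_snd)).aestronglyMeasurable
    · exact Eventually.of_forall fun p => hC _
    · exact Eventually.of_forall fun p => mul_assoc _ _ _
  calc ∫ x, (ρ ⋆[ContinuousLinearMap.lsmul ℝ ℝ, volume] u) x * k x
      = ∫ x, ∫ t, ρ t * u (x - t) * k x := by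
        refine integral_congr_ae (Eventually.of_forall fun x => ?_)
        simp only [convolution_def, ContinuousLinearMap.lsmul_apply, smul_eq_mul]
        rw [integral_mul_const]
    _ = ∫ t, ∫ x, ρ t * u (x - t) * k x := integral_integral_swap hint
    _ = ∫ t, ∫ x, u x * (ρ (-t) * k (x - -t)) := by
        refine integral_congr_ae (Eventually.of_forall fun t => ?_)
        simp only
        rw [← integral_add_right_eq_self _ t]
        refine integral_congr_ae (Eventually.of_forall fun x => ?_)
        simp only [add_sub_cancel_right, heven, sub_neg_eq_add]
        ring
    _ = ∫ t, ∫ x, u x * (ρ t * k (x - t)) :=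
        integral_neg_eq_self (fun t => ∫ x, u x * (ρ t * k (x - t))) volume
    _ = ∫ x, ∫ t, u x * (ρ t * k (x - t)) := (integral_integral_swap hint2).symm
    _ = ∫ x, u x * ∫ t, ρ t * k (x - t) := by
        refine integral_congr_ae (Eventually.of_forall fun x => ?_)
        simp only
        rw [integral_const_mul]

/-- A test field stays a test field after mollification if the closed thickening of its support
by the radius of the mollifier lies in `Ω`. -/
lemma convolution_mem_tvTestFields {Ω : Set (EuclideanSpace ℝ (Fin n))}
    (b : ContDiffBump (0 : EuclideanSpace ℝ (Fin n))) (hφ : φ ∈ tvTestFields Ω)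
    (hΩ : Metric.cthickening b.rOut (tsupport φ) ⊆ Ω) :
    b.normed volume ⋆[ContinuousLinearMap.lsmul ℝ ℝ, volume] φ ∈ tvTestFields Ω := by
  obtain ⟨h1, hc, -, hb⟩ := hφ
  refine ⟨hc.contDiff_convolution_right (n := 1) _ b.continuous_normed.locallyIntegrable h1,
    (b.hasCompactSupport_normed).convolution _ hc, ?_, fun x => ?_⟩
  · refine subset_trans (closure_minimal ?_ Metric.isClosed_cthickening) hΩ
    refine (support_convolution_subset _).trans ?_
    rintro _ ⟨y, hy, z, hz, rfl⟩
    rw [b.support_normed_eq] at hy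
    refine Metric.mem_cthickening_of_dist_le _ z _ _ (subset_tsupport _ hz) ?_
    simpa [dist_eq_norm] using (mem_ball_zero_iff.1 hy).le
  · rw [convolution_def]
    calc ‖∫ t, b.normed volume t • φ (x - t)‖ ≤ ∫ t, b.normed volume t := by
          refine norm_integral_le_of_norm_le b.integrable_normed (Eventually.of_forall fun t => ?_)
          rw [norm_smul, Real.norm_of_nonneg (b.nonneg_normed t)]
          exact mul_le_of_le_one_right (b.nonneg_normed t) (hb _)
      _ = 1 := b.integral_normed

end Mollify

/-! ### Elementary properties of the total variation -/

section TotalVariation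

variable {n : ℕ} {Ω : Set (EuclideanSpace ℝ (Fin n))} {u v : EuclideanSpace ℝ (Fin n) → ℝ}
  {φ ψ : EuclideanSpace ℝ (Fin n) → EuclideanSpace ℝ (Fin n)}

lemma vectorDiv_eq_zero_of_notMem (hφ : φ ∈ tvTestFields Ω) {x : EuclideanSpace ℝ (Fin n)}
    (hx : x ∉ Ω) : vectorDiv φ x = 0 := by
  rw [vectorDiv_eq_traceCLM]
  have : fderiv ℝ φ x = 0 := by
    by_contra h
    exact hx (hφ.2.2.1 (support_fderiv_subset ℝ h))
  rw [this, map_zero]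

lemma zero_mem_tvTestFields : (fun _ => 0) ∈ tvTestFields Ω := by
  refine ⟨contDiff_const, HasCompactSupport.zero, ?_, by simp⟩
  have : tsupport (fun _ : EuclideanSpace ℝ (Fin n) => (0 : EuclideanSpace ℝ (Fin n))) = ∅ :=
    tsupport_eq_empty_iff.2 rfl
  simp [this]

lemma vectorDiv_zero (x : EuclideanSpace ℝ (Fin n)) :
    vectorDiv (fun _ : EuclideanSpace ℝ (Fin n) => (0 : EuclideanSpace ℝ (Fin n))) x = 0 := by
  simp [vectorDiv]

lemma neg_mem_tvTestFields (hφ : φ ∈ tvTestFields Ω) : (fun x => -φ x) ∈ tvTestFields Ω := by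
  obtain ⟨h1, h2, h3, h4⟩ := hφ
  refine ⟨h1.neg, h2.comp_left (g := fun z => -z) neg_zero, ?_, by simpa using h4⟩
  refine (closure_mono ?_).trans h3
  intro x hx h0
  exact hx (by simp [h0])

lemma exists_bound_vectorDiv (hφ : φ ∈ tvTestFields Ω) : ∃ M, ∀ x, ‖vectorDiv φ x‖ ≤ M :=
  (hasCompactSupport_vectorDiv hφ.2.1).exists_bound_of_continuous (continuous_vectorDiv hφ.1)

lemma integrable_vectorDiv (hφ : φ ∈ tvTestFields Ω) : Integrable (vectorDiv φ) :=
  (continuous_vectorDiv hφ.1).integrable_of_hasCompactSupport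
    (hasCompactSupport_vectorDiv hφ.2.1)

lemma integrableOn_mul_vectorDiv (hu : IntegrableOn u Ω) (hφ : φ ∈ tvTestFields Ω) :
    IntegrableOn (fun x => u x * vectorDiv φ x) Ω := by
  obtain ⟨M, hM⟩ := exists_bound_vectorDiv hφ
  exact Integrable.mul_bdd (c := M) hu
    (continuous_vectorDiv hφ.1).aestronglyMeasurable (Eventually.of_forall hM)

lemma setIntegral_mul_vectorDiv (hφ : φ ∈ tvTestFields Ω)
    (u : EuclideanSpace ℝ (Fin n) → ℝ) :
    ∫ x in Ω, u x * vectorDiv φ x = ∫ x, u x * vectorDiv φ x :=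
  setIntegral_eq_integral_of_forall_compl_eq_zero fun x hx => by
    rw [vectorDiv_eq_zero_of_notMem hφ hx, mul_zero]

lemma setIntegral_vectorDiv_eq_zero (hφ : φ ∈ tvTestFields Ω) :
    ∫ x in Ω, vectorDiv φ x = 0 := by
  have := setIntegral_mul_vectorDiv hφ (fun _ => 1)
  simpa [integral_vectorDiv_eq_zero hφ.1 hφ.2.1] using this

lemma ofReal_integral_le_totalVariation (u : EuclideanSpace ℝ (Fin n) → ℝ)
    (hφ : φ ∈ tvTestFields Ω) :
    ENNReal.ofReal (∫ x in Ω, u x * vectorDiv φ x) ≤ totalVariation Ω u :=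
  le_iSup₂ (f := fun φ (_ : φ ∈ tvTestFields Ω) =>
    ENNReal.ofReal (∫ x in Ω, u x * vectorDiv φ x)) φ hφ

lemma integral_le_toReal_totalVariation (hu : totalVariation Ω u < ⊤) (hφ : φ ∈ tvTestFields Ω) :
    ∫ x in Ω, u x * vectorDiv φ x ≤ (totalVariation Ω u).toReal :=
  (ENNReal.ofReal_le_iff_le_toReal hu.ne).1 (ofReal_integral_le_totalVariation u hφ)

lemma totalVariation_le_ofReal {C : ℝ}
    (h : ∀ φ ∈ tvTestFields Ω, ∫ x in Ω, u x * vectorDiv φ x ≤ C) :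
    totalVariation Ω u ≤ ENNReal.ofReal C :=
  iSup₂_le fun φ hφ => ENNReal.ofReal_le_ofReal (h φ hφ)

lemma totalVariation_const_sub (hu : IntegrableOn u Ω) (a : ℝ) :
    totalVariation Ω (fun x => a - u x) = totalVariation Ω u := by
  have key : ∀ φ ∈ tvTestFields Ω, ∫ x in Ω, (a - u x) * vectorDiv φ x =
      ∫ x in Ω, u x * vectorDiv (fun y => -φ y) x := by
    intro φ hφ
    have i1 : IntegrableOn (fun x => a * vectorDiv φ x) Ω :=
      ((integrable_vectorDiv hφ).const_mul a).integrableOn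
    simp only [vectorDiv_neg, sub_mul, mul_neg]
    rw [integral_sub i1 (integrableOn_mul_vectorDiv hu hφ), integral_const_mul,
      setIntegral_vectorDiv_eq_zero hφ, integral_neg]
    ring
  apply le_antisymm
  · refine iSup₂_le fun φ hφ => ?_
    rw [key φ hφ]
    exact ofReal_integral_le_totalVariation u (neg_mem_tvTestFields hφ)
  · refine iSup₂_le fun φ hφ => ?_
    have := key _ (neg_mem_tvTestFields hφ)
    simp only [neg_neg] at this
    rw [← this]
    exact ofReal_integral_le_totalVariation (fun x => a - u x) (neg_mem_tvTestFields hφ)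

/-- The total variation is sublinear. -/
lemma totalVariation_add_le (hu : IntegrableOn u Ω) (hv : IntegrableOn v Ω) {a b : ℝ}
    (ha : 0 ≤ a) (hb : 0 ≤ b) :
    totalVariation Ω (fun x => a * u x + b * v x) ≤
      ENNReal.ofReal a * totalVariation Ω u + ENNReal.ofReal b * totalVariation Ω v := by
  refine iSup₂_le fun φ hφ => ?_
  have : ∫ x in Ω, (a * u x + b * v x) * vectorDiv φ x =
      a * (∫ x in Ω, u x * vectorDiv φ x) + b * ∫ x in Ω, v x * vectorDiv φ x := by
    simp only [add_mul, mul_assoc]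
    rw [integral_add ((integrableOn_mul_vectorDiv hu hφ).const_mul a)
      ((integrableOn_mul_vectorDiv hv hφ).const_mul b), integral_const_mul, integral_const_mul]
  rw [this]
  refine ENNReal.ofReal_add_le.trans ?_
  rw [ENNReal.ofReal_mul ha, ENNReal.ofReal_mul hb]
  gcongr <;> exact ofReal_integral_le_totalVariation _ hφ

lemma totalVariation_zero : totalVariation Ω (fun _ => 0) = 0 := by
  simp [totalVariation]

/-- Lower semicontinuity of the total variation, in the weak topology generated by the
divergences of test fields. -/
lemma totalVariation_le_of_tendsto {w : ℕ → EuclideanSpace ℝ (Fin n) → ℝ} {C : ℝ≥0∞}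
    (hw : ∀ φ ∈ tvTestFields Ω, Tendsto (fun k => ∫ x in Ω, w k x * vectorDiv φ x) atTop
      (𝓝 (∫ x in Ω, u x * vectorDiv φ x)))
    {c : ℕ → ℝ≥0∞} (hc : Tendsto c atTop (𝓝 C)) (hle : ∀ k, totalVariation Ω (w k) ≤ c k) :
    totalVariation Ω u ≤ C := by
  refine iSup₂_le fun φ hφ => ?_
  exact le_of_tendsto_of_tendsto' ((ENNReal.continuous_ofReal.tendsto _).comp (hw φ hφ)) hc
    fun k => (ofReal_integral_le_totalVariation (w k) hφ).trans (hle k)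

end TotalVariation

/-! ### Splitting the total variation at a level -/

section Splitting

open scoped Convolution

variable {n : ℕ} {Ω : Set (EuclideanSpace ℝ (Fin n))} {u : EuclideanSpace ℝ (Fin n) → ℝ}
  {φ ψ : EuclideanSpace ℝ (Fin n) → EuclideanSpace ℝ (Fin n)}

/-- Splitting by smooth profiles `f` and `h` with `|f'| + |h'| ≤ 1`. Testing `f ∘ w` with `φ` and
`h ∘ w` with `ψ` amounts to testing the mollification `w` of `u` with the single admissible field
`f'(w) φ + h'(w) ψ`; the mollification is then moved onto that field. -/
lemma integral_comp_mollification_add_le (hΩ : IsOpen Ω) (hu : IntegrableOn u Ω) {C : ℝ}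
    (hC : ∀ φ ∈ tvTestFields Ω, ∫ x in Ω, u x * vectorDiv φ x ≤ C) {f h : ℝ → ℝ}
    (hf : ContDiff ℝ 2 f) (hh : ContDiff ℝ 2 h) (hfh : ∀ t, |deriv f t| + |deriv h t| ≤ 1)
    (hφ : φ ∈ tvTestFields Ω) (hψ : ψ ∈ tvTestFields Ω)
    (b : ContDiffBump (0 : EuclideanSpace ℝ (Fin n)))
    (hb : Metric.cthickening b.rOut (tsupport φ ∪ tsupport ψ) ⊆ Ω)
    {w : EuclideanSpace ℝ (Fin n) → ℝ} (hw : ContDiff ℝ 1 w)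
    (hwU : w = b.normed volume ⋆[ContinuousLinearMap.lsmul ℝ ℝ, volume] Ω.indicator u) :
    (∫ x, f (w x) * vectorDiv φ x) + ∫ x, h (w x) * vectorDiv ψ x ≤ C := by
  have hf1 : ContDiff ℝ 1 (fun y => deriv f (w y) • φ y) :=
    ((hf.deriv' : ContDiff ℝ 1 (deriv f)).comp hw).smul hφ.1
  have hh1 : ContDiff ℝ 1 (fun y => deriv h (w y) • ψ y) :=
    ((hh.deriv' : ContDiff ℝ 1 (deriv h)).comp hw).smul hψ.1
  have hfc : HasCompactSupport (fun y => deriv f (w y) • φ y) :=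
    HasCompactSupport.smul_left (f := fun y => deriv f (w y)) (f' := φ) hφ.2.1
  have hhc : HasCompactSupport (fun y => deriv h (w y) • ψ y) :=
    HasCompactSupport.smul_left (f := fun y => deriv h (w y)) (f' := ψ) hψ.2.1
  obtain ⟨Φ, hΦ⟩ : ∃ Φ : EuclideanSpace ℝ (Fin n) → EuclideanSpace ℝ (Fin n),
    Φ = fun y => deriv f (w y) • φ y + deriv h (w y) • ψ y := ⟨_, rfl⟩
  have hΦ1 : ContDiff ℝ 1 Φ := hΦ ▸ hf1.add hh1
  have hΦc : HasCompactSupport Φ := hΦ ▸ hfc.add hhc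
  have hΦs : tsupport Φ ⊆ tsupport φ ∪ tsupport ψ := by
    refine closure_minimal ?_ ((isClosed_tsupport _).union (isClosed_tsupport _))
    intro x hx
    by_contra hcon
    rw [mem_union, not_or] at hcon
    apply hx
    simp only [hΦ, image_eq_zero_of_notMem_tsupport hcon.1,
      image_eq_zero_of_notMem_tsupport hcon.2, smul_zero, add_zero]
  have hΦb : ∀ x, ‖Φ x‖ ≤ 1 := by
    intro x
    calc ‖Φ x‖ ≤ |deriv f (w x)| * ‖φ x‖ + |deriv h (w x)| * ‖ψ x‖ := by
          rw [hΦ]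
          simpa only [norm_smul, Real.norm_eq_abs] using
            norm_add_le (deriv f (w x) • φ x) (deriv h (w x) • ψ x)
      _ ≤ |deriv f (w x)| * 1 + |deriv h (w x)| * 1 := by
          gcongr
          · exact hφ.2.2.2 x
          · exact hψ.2.2.2 x
      _ ≤ 1 := by simpa using hfh (w x)
  have hthick : Metric.cthickening b.rOut (tsupport Φ) ⊆ Ω :=
    (Metric.cthickening_subset_of_subset _ hΦs).trans hb
  have hΦtest : Φ ∈ tvTestFields Ω := ⟨hΦ1, hΦc,
    (Metric.self_subset_cthickening _).trans hthick, hΦb⟩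
  have hUint : Integrable (Ω.indicator u) := (integrable_indicator_iff hΩ.measurableSet).2 hu
  rw [integral_comp_mul_vectorDiv hw hf hφ.1 hφ.2.1,
    integral_comp_mul_vectorDiv hw hh hψ.1 hψ.2.1, ← integral_add]
  · calc _ = ∫ x, w x * vectorDiv Φ x := by
          refine integral_congr_ae (Eventually.of_forall fun x => ?_)
          simp only
          rw [hΦ, vectorDiv_add hf1 hh1, mul_add]
      _ = ∫ x, Ω.indicator u x * ∫ t, b.normed volume t * vectorDiv Φ (x - t) := by
          rw [hwU]
          exact integral_convolution_mul b.continuous_normed b.hasCompactSupport_normed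
            b.normed_neg hUint (continuous_vectorDiv hΦ1) (hasCompactSupport_vectorDiv hΦc)
      _ = ∫ x, Ω.indicator (fun x => u x * vectorDiv (b.normed volume
            ⋆[ContinuousLinearMap.lsmul ℝ ℝ, volume] Φ) x) x := by
          refine integral_congr_ae (Eventually.of_forall fun x => ?_)
          have := vectorDiv_convolution (b.continuous_normed (μ := volume)) hΦ1 hΦc x
          by_cases hx : x ∈ Ω <;> simp [hx, this]
      _ ≤ C := by
          rw [integral_indicator hΩ.measurableSet]
          exact hC _ (convolution_mem_tvTestFields b hΦtest hthick)
  · exact (hw.continuous.mul (continuous_vectorDiv hf1)).integrable_of_hasCompactSupport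
      (hasCompactSupport_vectorDiv hfc).mul_left
  · exact (hw.continuous.mul (continuous_vectorDiv hh1)).integrable_of_hasCompactSupport
      (hasCompactSupport_vectorDiv hhc).mul_left

/-- Splitting by smooth bounded profiles: the mollification scale is sent to `0` in
`integral_comp_mollification_add_le`. Boundedness of the profiles makes almost everywhere
convergence of the mollifications sufficient. -/
lemma integral_comp_add_integral_comp_le (hΩ : IsOpen Ω) (hu : IntegrableOn u Ω) {C : ℝ}
    (hC : ∀ φ ∈ tvTestFields Ω, ∫ x in Ω, u x * vectorDiv φ x ≤ C) {f h : ℝ → ℝ}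
    (hf : ContDiff ℝ 2 f) (hh : ContDiff ℝ 2 h) {M : ℝ} (hfM : ∀ t, |f t| ≤ M)
    (hhM : ∀ t, |h t| ≤ M) (hfh : ∀ t, |deriv f t| + |deriv h t| ≤ 1)
    (hφ : φ ∈ tvTestFields Ω) (hψ : ψ ∈ tvTestFields Ω) :
    (∫ x in Ω, f (u x) * vectorDiv φ x) + ∫ x in Ω, h (u x) * vectorDiv ψ x ≤ C := by
  set U : EuclideanSpace ℝ (Fin n) → ℝ := Ω.indicator u with hU
  have hUint : Integrable U := (integrable_indicator_iff hΩ.measurableSet).2 hu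
  obtain ⟨δ, hδ, hδΩ⟩ := (hφ.2.1.isCompact.union hψ.2.1.isCompact).exists_cthickening_subset_open
    hΩ (union_subset hφ.2.2.1 hψ.2.2.1)
  let b : ℕ → ContDiffBump (0 : EuclideanSpace ℝ (Fin n)) := fun k =>
    ⟨δ / (k + 1) / 2, δ / (k + 1), by positivity, half_lt_self (by positivity)⟩
  have hbr : ∀ k, (b k).rOut = δ / (k + 1) := fun k => rfl
  have hbr' : ∀ k, (b k).rIn = δ / (k + 1) / 2 := fun k => rfl
  have hb0 : Tendsto (fun k => (b k).rOut) atTop (𝓝 0) := by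
    simp only [hbr]
    exact tendsto_const_div_atTop_nhds_zero_nat δ |>.comp (tendsto_add_atTop_nat 1) |>.congr
      fun k => by simp
  let w : ℕ → EuclideanSpace ℝ (Fin n) → ℝ := fun k =>
    (b k).normed volume ⋆[ContinuousLinearMap.lsmul ℝ ℝ, volume] U
  have hwU : ∀ᵐ x, Tendsto (fun k => w k x) atTop (𝓝 (U x)) :=
    ContDiffBump.ae_convolution_tendsto_right_of_locallyIntegrable (K := 2) hb0
      (Eventually.of_forall fun k => by rw [hbr, hbr']; linarith) hUint.locallyIntegrable
  have hw : ∀ k, ContDiff ℝ 1 (w k) := fun k =>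
    (b k).hasCompactSupport_normed.contDiff_convolution_left (n := 1) _ (b k).contDiff_normed
      hUint.locallyIntegrable
  have hstep : ∀ k, (∫ x, f (w k x) * vectorDiv φ x) + ∫ x, h (w k x) * vectorDiv ψ x ≤ C :=
    fun k => integral_comp_mollification_add_le hΩ hu hC hf hh hfh hφ hψ (b k)
      ((Metric.cthickening_mono (by rw [hbr]; exact div_le_self hδ.le (by simp)) _).trans hδΩ)
      (hw k) rfl
  have hlim : ∀ {g : ℝ → ℝ} {χ : EuclideanSpace ℝ (Fin n) → EuclideanSpace ℝ (Fin n)},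
      Continuous g → (∀ t, |g t| ≤ M) → χ ∈ tvTestFields Ω →
      Tendsto (fun k => ∫ x, g (w k x) * vectorDiv χ x) atTop
        (𝓝 (∫ x in Ω, g (u x) * vectorDiv χ x)) := by
    intro g χ hg hgM hχ
    have hrw : ∫ x in Ω, g (u x) * vectorDiv χ x = ∫ x, g (U x) * vectorDiv χ x := by
      rw [setIntegral_mul_vectorDiv hχ fun x => g (u x)]
      refine integral_congr_ae (Eventually.of_forall fun x => ?_)
      by_cases hx : x ∈ Ω
      · simp [hU, hx]
      · simp [vectorDiv_eq_zero_of_notMem hχ hx]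
    rw [hrw]
    refine tendsto_integral_of_dominated_convergence (fun x => M * ‖vectorDiv χ x‖) ?_ ?_ ?_ ?_
    · exact fun k => ((hg.comp (hw k).continuous).mul
        (continuous_vectorDiv hχ.1)).aestronglyMeasurable
    · exact (integrable_vectorDiv hχ).norm.const_mul M
    · refine fun k => Eventually.of_forall fun x => ?_
      rw [norm_mul]
      exact mul_le_mul_of_nonneg_right (hgM _) (norm_nonneg _)
    · filter_upwards [hwU] with x hx
      exact ((hg.tendsto _).comp hx).mul_const _
  exact le_of_tendsto' ((hlim hf.continuous hfM hφ).add (hlim hh.continuous hhM hψ)) hstep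

lemma abs_arctan_le_abs (x : ℝ) : |Real.arctan x| ≤ |x| := by
  have key : ∀ y : ℝ, 0 ≤ y → Real.arctan y ≤ y := by
    intro y hy
    have := Real.le_tan (Real.arctan_nonneg.2 hy) (Real.arctan_lt_pi_div_two y)
    rwa [Real.tan_arctan] at this
  rcases le_total 0 x with hx | hx
  · rw [abs_of_nonneg hx, abs_of_nonneg (Real.arctan_nonneg.2 hx)]
    exact key x hx
  · have := key (-x) (by linarith)
    rw [Real.arctan_neg] at this
    rw [abs_of_nonpos hx, abs_of_nonpos (Real.arctan_le_zero.2 hx)]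
    exact this

/-- A bounded smooth approximation `(√(T² + s²) + T) / 2`, with `T = arctan (s t) / s`, of the
positive part of `t`, which it converges to as `s ↓ 0`. -/
noncomputable def smoothPosPart (s t : ℝ) : ℝ :=
  (√((s⁻¹ * Real.arctan (s * t)) ^ 2 + s ^ 2) + s⁻¹ * Real.arctan (s * t)) / 2

lemma contDiff_smoothPosPart {s : ℝ} (hs : 0 < s) : ContDiff ℝ 2 (smoothPosPart s) := by
  have h1 : ContDiff ℝ 2 fun t : ℝ => s⁻¹ * Real.arctan (s * t) :=
    contDiff_const.mul (contDiff_const.mul contDiff_id).arctan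
  exact ((((h1.pow 2).add contDiff_const).sqrt fun t => by positivity).add h1).div_const 2

lemma abs_inv_mul_arctan_le {s : ℝ} (hs : 0 < s) (t : ℝ) :
    |s⁻¹ * Real.arctan (s * t)| ≤ |t| := by
  rw [abs_mul, abs_of_pos (inv_pos.2 hs), inv_mul_le_iff₀ hs]
  simpa [abs_mul, abs_of_pos hs] using abs_arctan_le_abs (s * t)

lemma abs_smoothPosPart_le_aux {s : ℝ} (hs : 0 < s) (t : ℝ) :
    |smoothPosPart s t| ≤ |s⁻¹ * Real.arctan (s * t)| + s := by
  set T := s⁻¹ * Real.arctan (s * t)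
  have h1 : √(T ^ 2 + s ^ 2) ≤ |T| + s := by
    rw [Real.sqrt_le_left (by positivity)]
    nlinarith [sq_abs T, abs_nonneg T]
  have h2 := Real.sqrt_nonneg (T ^ 2 + s ^ 2)
  have h3 := le_abs_self T
  have h4 := neg_abs_le T
  have : smoothPosPart s t = (√(T ^ 2 + s ^ 2) + T) / 2 := rfl
  rw [this, abs_le]
  constructor <;> linarith [abs_nonneg T]

lemma abs_smoothPosPart_le {s : ℝ} (hs : 0 < s) (t : ℝ) : |smoothPosPart s t| ≤ |t| + s :=
  (abs_smoothPosPart_le_aux hs t).trans (add_le_add_left (abs_inv_mul_arctan_le hs t) s)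

lemma abs_smoothPosPart_le_const {s : ℝ} (hs : 0 < s) (t : ℝ) :
    |smoothPosPart s t| ≤ s⁻¹ * (Real.pi / 2) + s := by
  refine (abs_smoothPosPart_le_aux hs t).trans ?_
  gcongr
  rw [abs_mul, abs_of_pos (inv_pos.2 hs)]
  gcongr
  exact abs_le.2 ⟨(Real.neg_pi_div_two_lt_arctan _).le, (Real.arctan_lt_pi_div_two _).le⟩

lemma abs_deriv_smoothPosPart_add_le {s : ℝ} (hs : 0 < s) (t : ℝ) :
    |deriv (smoothPosPart s) t| + |deriv (fun r => smoothPosPart s (-r)) t| ≤ 1 := by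
  have hT : ∀ r, HasDerivAt (fun t : ℝ => s⁻¹ * Real.arctan (s * t)) (1 / (1 + (s * r) ^ 2)) r := by
    intro r
    have h := ((hasDerivAt_id r).const_mul s).arctan.const_mul s⁻¹
    refine h.congr_deriv ?_
    simp only [id]
    field_simp
  have hD : ∀ r, deriv (smoothPosPart s) r = 1 / (1 + (s * r) ^ 2) *
      ((s⁻¹ * Real.arctan (s * r) / √((s⁻¹ * Real.arctan (s * r)) ^ 2 + s ^ 2) + 1) / 2) := by
    intro r
    have hpos : 0 < (s⁻¹ * Real.arctan (s * r)) ^ 2 + s ^ 2 := by positivity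
    have h := (((((hT r).pow 2).add_const (s ^ 2)).sqrt hpos.ne').add (hT r)).div_const 2
    refine h.deriv.trans ?_
    have := (Real.sqrt_pos.2 hpos).ne'
    simp only [Nat.cast_ofNat, Pi.pow_apply, Nat.add_one_sub_one, pow_one]
    generalize √((s⁻¹ * Real.arctan (s * r)) ^ 2 + s ^ 2) = R at this ⊢
    generalize s⁻¹ * Real.arctan (s * r) = T
    have : 1 + (s * r) ^ 2 ≠ 0 := by positivity
    field_simp
  rw [deriv_comp_neg (smoothPosPart s) t, abs_neg, hD, hD]
  simp only [mul_neg, Real.arctan_neg, neg_sq]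
  set T := s⁻¹ * Real.arctan (s * t)
  have hpos : 0 < T ^ 2 + s ^ 2 := by positivity
  have hq : |T / √(T ^ 2 + s ^ 2)| ≤ 1 := by
    rw [abs_div, abs_of_nonneg (Real.sqrt_nonneg _), div_le_one (Real.sqrt_pos.2 hpos)]
    exact Real.abs_le_sqrt (by nlinarith)
  rw [neg_div]
  set q := T / √(T ^ 2 + s ^ 2)
  have hT0 : 0 ≤ 1 / (1 + (s * t) ^ 2) := by positivity
  have hT1 : 1 / (1 + (s * t) ^ 2) ≤ 1 := by
    rw [div_le_one (by positivity)]; nlinarith [sq_nonneg (s * t)]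
  obtain ⟨hq1, hq2⟩ := abs_le.1 hq
  rw [abs_of_nonneg (mul_nonneg hT0 (by linarith)), abs_of_nonneg (mul_nonneg hT0 (by linarith))]
  linarith

lemma tendsto_smoothPosPart (t : ℝ) :
    Tendsto (fun k : ℕ => smoothPosPart (1 / ((k : ℝ) + 1)) t) atTop (𝓝 (max t 0)) := by
  have hs0 : Tendsto (fun k : ℕ => 1 / ((k : ℝ) + 1)) atTop (𝓝 0) :=
    tendsto_one_div_add_atTop_nhds_zero_nat
  have hs : Tendsto (fun k : ℕ => 1 / ((k : ℝ) + 1)) atTop (𝓝[≠] 0) :=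
    tendsto_nhdsWithin_iff.2 ⟨hs0, Eventually.of_forall fun k => by
      simp only [mem_compl_iff, mem_singleton_iff]; positivity⟩
  have hd : HasDerivAt (fun s : ℝ => Real.arctan (s * t)) t 0 := by
    have := ((hasDerivAt_id (0 : ℝ)).mul_const t).arctan
    simpa using this
  have hT : Tendsto (fun k : ℕ => (1 / ((k : ℝ) + 1))⁻¹ * Real.arctan (1 / ((k : ℝ) + 1) * t))
      atTop (𝓝 t) := by
    have := hd.tendsto_slope_zero.comp hs
    simpa [Function.comp_def] using this
  have hlim := (((hT.pow 2).add (hs0.pow 2)).sqrt.add hT).div_const 2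
  have : (√(t ^ 2 + 0 ^ 2) + t) / 2 = max t 0 := by
    rw [zero_pow two_ne_zero, add_zero, Real.sqrt_sq_eq_abs]
    rcases le_total 0 t with h | h
    · rw [abs_of_nonneg h, max_eq_left h]; ring
    · rw [abs_of_nonpos h, max_eq_right h]; ring
  rw [← this]
  exact hlim

/-- The part of `u` above `0` and the part below `0` together have no more variation than `u`. -/
lemma totalVariation_posPart_add_negPart_le (hΩ : IsOpen Ω) (hu : IntegrableOn u Ω) :
    totalVariation Ω (fun x => max (u x) 0) + totalVariation Ω (fun x => max (-u x) 0) ≤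
      totalVariation Ω u := by
  rcases eq_top_or_lt_top (totalVariation Ω u) with htop | hfin
  · simp [htop]
  set C := (totalVariation Ω u).toReal with hCdef
  have hC : ∀ φ ∈ tvTestFields Ω, ∫ x in Ω, u x * vectorDiv φ x ≤ C :=
    fun φ hφ => integral_le_toReal_totalVariation hfin hφ
  have hlim : ∀ {v : EuclideanSpace ℝ (Fin n) → ℝ}
      {χ : EuclideanSpace ℝ (Fin n) → EuclideanSpace ℝ (Fin n)},
      IntegrableOn v Ω → χ ∈ tvTestFields Ω →
      Tendsto (fun k : ℕ => ∫ x in Ω, smoothPosPart (1 / ((k : ℝ) + 1)) (v x) * vectorDiv χ x)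
        atTop (𝓝 (∫ x in Ω, max (v x) 0 * vectorDiv χ x)) := by
    intro v χ hv hχ
    refine tendsto_integral_of_dominated_convergence
      (fun x => |v x * vectorDiv χ x| + |vectorDiv χ x|) ?_ ?_ ?_ ?_
    · exact fun k => ((contDiff_smoothPosPart (by positivity)).continuous.comp_aestronglyMeasurable
        hv.aestronglyMeasurable).mul (continuous_vectorDiv hχ.1).aestronglyMeasurable
    · exact (integrableOn_mul_vectorDiv hv hχ).abs.add (integrable_vectorDiv hχ).abs.integrableOn
    · refine fun k => Eventually.of_forall fun x => ?_
      rw [Real.norm_eq_abs, abs_mul, abs_mul, ← add_one_mul]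
      refine mul_le_mul_of_nonneg_right ((abs_smoothPosPart_le (by positivity) _).trans ?_)
        (abs_nonneg _)
      gcongr
      rw [div_le_one (by positivity)]
      linarith [(Nat.cast_nonneg k : (0 : ℝ) ≤ k)]
    · exact Eventually.of_forall fun x => (tendsto_smoothPosPart (v x)).mul_const _
  have hsum : ∀ φ ∈ tvTestFields Ω, ∀ ψ ∈ tvTestFields Ω,
      (∫ x in Ω, max (u x) 0 * vectorDiv φ x) + ∫ x in Ω, max (-u x) 0 * vectorDiv ψ x ≤ C := by
    intro φ hφ ψ hψ
    refine le_of_tendsto' ((hlim hu hφ).add (hlim hu.neg hψ)) fun k => ?_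
    have hs : (0 : ℝ) < 1 / ((k : ℝ) + 1) := by positivity
    exact integral_comp_add_integral_comp_le hΩ hu hC (contDiff_smoothPosPart hs)
      ((contDiff_smoothPosPart hs).comp contDiff_neg) (abs_smoothPosPart_le_const hs)
      (fun t => abs_smoothPosPart_le_const hs (-t)) (abs_deriv_smoothPosPart_add_le hs) hφ hψ
  have h0 := zero_mem_tvTestFields (Ω := Ω)
  refine ENNReal.biSup_add_biSup_le ⟨_, h0⟩ ⟨_, h0⟩ fun φ hφ ψ hψ => ?_
  rw [← ENNReal.ofReal_toReal hfin.ne, ← hCdef]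
  -- a negative integral is cut off at `0`, its value at the zero field
  have a1 := hsum φ hφ ψ hψ
  have a2 := hsum φ hφ _ h0
  have a3 := hsum _ h0 ψ hψ
  simp only [vectorDiv_zero, mul_zero, integral_zero, add_zero, zero_add] at a2 a3
  change ENNReal.ofReal (∫ x in Ω, max (u x) 0 * vectorDiv φ x) +
    ENNReal.ofReal (∫ x in Ω, max (-u x) 0 * vectorDiv ψ x) ≤ _
  rcases le_total (∫ x in Ω, max (u x) 0 * vectorDiv φ x) 0 with h | h
  · rw [ENNReal.ofReal_of_nonpos h, zero_add]
    exact ENNReal.ofReal_le_ofReal a3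
  rcases le_total (∫ x in Ω, max (-u x) 0 * vectorDiv ψ x) 0 with h' | h'
  · rw [ENNReal.ofReal_of_nonpos h', add_zero]
    exact ENNReal.ofReal_le_ofReal a2
  rw [← ENNReal.ofReal_add h h']
  exact ENNReal.ofReal_le_ofReal a1

/-- Splitting of the total variation at an arbitrary level `s`. -/
lemma totalVariation_min_add_le (hΩ : IsOpen Ω) [IsFiniteMeasure (volume.restrict Ω)]
    (hu : IntegrableOn u Ω) (s : ℝ) :
    totalVariation Ω (fun x => min (u x) s) + totalVariation Ω (fun x => max (u x - s) 0) ≤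
      totalVariation Ω u := by
  have hs : IntegrableOn (fun _ : EuclideanSpace ℝ (Fin n) => s) Ω := integrable_const s
  have h := totalVariation_posPart_add_negPart_le hΩ (hs.sub hu)
  have e1 : totalVariation Ω (fun x => min (u x) s) =
      totalVariation Ω (fun x => max (s - u x) 0) := by
    rw [← totalVariation_const_sub (u := fun x => max (s - u x) 0) (hs.sub hu).pos_part s]
    congr 1
    ext x
    rcases le_total (u x) s with hx | hx <;> simp [hx]
  have e2 : (fun x => max (u x - s) 0) = fun x => max (-(s - u x)) 0 := by simp
  rw [e1, e2]
  exact h.trans_eq (totalVariation_const_sub hu s)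

end Splitting

/-! ### The data term on bounded functions -/

section DataTerm

variable {n : ℕ} {Ω : Set (EuclideanSpace ℝ (Fin n))}
  {θ₁ θ₂ u v w : EuclideanSpace ℝ (Fin n) → ℝ}

/-- The integrand `u² θ₁ + (1 - u)² θ₂` of the data term of the relaxed energy. -/
def dataDensity (θ₁ θ₂ u : EuclideanSpace ℝ (Fin n) → ℝ) (x : EuclideanSpace ℝ (Fin n)) : ℝ :=
  u x ^ 2 * θ₁ x + (1 - u x) ^ 2 * θ₂ x

/-- The negative derivative `2 (1 - u) θ₂ - 2 u θ₁` of the data term at `u`. -/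
def descentDensity (θ₁ θ₂ u : EuclideanSpace ℝ (Fin n) → ℝ) (x : EuclideanSpace ℝ (Fin n)) : ℝ :=
  2 * (1 - u x) * θ₂ x - 2 * u x * θ₁ x

lemma integrable_mul_of_memLp_top {θ : EuclideanSpace ℝ (Fin n) → ℝ} (hθ : IntegrableOn θ Ω)
    (hw : MemLp w ⊤ (volume.restrict Ω)) : IntegrableOn (fun x => w x * θ x) Ω :=
  Integrable.mul_of_top_right hθ hw

lemma memLp_top_pow_two (hw : MemLp w ⊤ (volume.restrict Ω)) :
    MemLp (fun x => w x ^ 2) ⊤ (volume.restrict Ω) := by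
  simpa only [pow_two] using hw.mul' (r := ⊤) hw

lemma memLp_top_one_sub (hw : MemLp w ⊤ (volume.restrict Ω)) :
    MemLp (fun x => 1 - w x) ⊤ (volume.restrict Ω) :=
  (memLp_top_const 1).sub hw

lemma integrableOn_dataDensity (hθ₁ : IntegrableOn θ₁ Ω) (hθ₂ : IntegrableOn θ₂ Ω)
    (hu : MemLp u ⊤ (volume.restrict Ω)) : IntegrableOn (dataDensity θ₁ θ₂ u) Ω :=
  (integrable_mul_of_memLp_top hθ₁ (memLp_top_pow_two hu)).add
    (integrable_mul_of_memLp_top hθ₂ (memLp_top_pow_two (memLp_top_one_sub hu)))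

lemma integrableOn_descentDensity (hθ₁ : IntegrableOn θ₁ Ω) (hθ₂ : IntegrableOn θ₂ Ω)
    (hu : MemLp u ⊤ (volume.restrict Ω)) : IntegrableOn (descentDensity θ₁ θ₂ u) Ω :=
  (integrable_mul_of_memLp_top hθ₂ ((memLp_top_one_sub hu).const_mul 2)).sub
    (integrable_mul_of_memLp_top hθ₁ (hu.const_mul 2))

/-- The data term is quadratic along segments. -/
lemma integral_dataDensity_segment (hθ₁ : IntegrableOn θ₁ Ω) (hθ₂ : IntegrableOn θ₂ Ω)
    (hu : MemLp u ⊤ (volume.restrict Ω)) (hv : MemLp v ⊤ (volume.restrict Ω)) (t : ℝ) :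
    ∫ x in Ω, dataDensity θ₁ θ₂ (fun y => (1 - t) * u y + t * v y) x =
      (∫ x in Ω, dataDensity θ₁ θ₂ u x) - t * (∫ x in Ω, (v x - u x) * descentDensity θ₁ θ₂ u x) +
        t ^ 2 * ∫ x in Ω, (v x - u x) ^ 2 * (θ₁ x + θ₂ x) := by
  have i1 := integrableOn_dataDensity hθ₁ hθ₂ hu
  have i2 : IntegrableOn (fun x => (v x - u x) * descentDensity θ₁ θ₂ u x) Ω :=
    integrable_mul_of_memLp_top (integrableOn_descentDensity hθ₁ hθ₂ hu) (hv.sub hu)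
  have i3 : IntegrableOn (fun x => (v x - u x) ^ 2 * (θ₁ x + θ₂ x)) Ω :=
    integrable_mul_of_memLp_top (hθ₁.add hθ₂) (memLp_top_pow_two (hv.sub hu))
  have i4 : IntegrableOn (fun x => dataDensity θ₁ θ₂ u x -
      t * ((v x - u x) * descentDensity θ₁ θ₂ u x)) Ω := i1.sub (i2.const_mul t)
  rw [← integral_const_mul, ← integral_const_mul, ← integral_sub i1 (i2.const_mul t),
    ← integral_add i4 (i3.const_mul _)]
  refine integral_congr_ae (Eventually.of_forall fun x => ?_)
  simp only [dataDensity, descentDensity]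
  ring

lemma dataDensity_nonneg {x : EuclideanSpace ℝ (Fin n)} (h₁ : 0 ≤ θ₁ x) (h₂ : 0 ≤ θ₂ x)
    (u : EuclideanSpace ℝ (Fin n) → ℝ) : 0 ≤ dataDensity θ₁ θ₂ u x := by
  unfold dataDensity; positivity

lemma relaxedEnergy_eq (hθ₁ : IntegrableOn θ₁ Ω) (hθ₂ : IntegrableOn θ₂ Ω)
    (h₁ : ∀ᵐ x ∂(volume.restrict Ω), 0 ≤ θ₁ x) (h₂ : ∀ᵐ x ∂(volume.restrict Ω), 0 ≤ θ₂ x)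
    (hu : MemLp u ⊤ (volume.restrict Ω)) :
    relaxedEnergy Ω θ₁ θ₂ u =
      ENNReal.ofReal (∫ x in Ω, dataDensity θ₁ θ₂ u x) + totalVariation Ω u := by
  rw [ofReal_integral_eq_lintegral_ofReal (integrableOn_dataDensity hθ₁ hθ₂ hu)]
  · rfl
  · filter_upwards [h₁, h₂] with x hx₁ hx₂ using dataDensity_nonneg hx₁ hx₂ u

lemma integral_dataDensity_nonneg
    (h₁ : ∀ᵐ x ∂(volume.restrict Ω), 0 ≤ θ₁ x) (h₂ : ∀ᵐ x ∂(volume.restrict Ω), 0 ≤ θ₂ x) :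
    0 ≤ ∫ x in Ω, dataDensity θ₁ θ₂ u x :=
  integral_nonneg_of_ae (by
    filter_upwards [h₁, h₂] with x hx₁ hx₂ using dataDensity_nonneg hx₁ hx₂ u)

lemma toReal_relaxedEnergy (hθ₁ : IntegrableOn θ₁ Ω) (hθ₂ : IntegrableOn θ₂ Ω)
    (h₁ : ∀ᵐ x ∂(volume.restrict Ω), 0 ≤ θ₁ x) (h₂ : ∀ᵐ x ∂(volume.restrict Ω), 0 ≤ θ₂ x)
    (hu : MemLp u ⊤ (volume.restrict Ω)) (huTV : totalVariation Ω u < ⊤) :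
    (relaxedEnergy Ω θ₁ θ₂ u).toReal =
      (∫ x in Ω, dataDensity θ₁ θ₂ u x) + (totalVariation Ω u).toReal := by
  rw [relaxedEnergy_eq hθ₁ hθ₂ h₁ h₂ hu, ENNReal.toReal_add ENNReal.ofReal_ne_top huTV.ne,
    ENNReal.toReal_ofReal (integral_dataDensity_nonneg h₁ h₂)]

lemma relaxedEnergy_lt_top (hθ₁ : IntegrableOn θ₁ Ω) (hθ₂ : IntegrableOn θ₂ Ω)
    (h₁ : ∀ᵐ x ∂(volume.restrict Ω), 0 ≤ θ₁ x) (h₂ : ∀ᵐ x ∂(volume.restrict Ω), 0 ≤ θ₂ x)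
    (hu : MemLp u ⊤ (volume.restrict Ω)) (huTV : totalVariation Ω u < ⊤) :
    relaxedEnergy Ω θ₁ θ₂ u < ⊤ := by
  rw [relaxedEnergy_eq hθ₁ hθ₂ h₁ h₂ hu]
  exact ENNReal.add_lt_top.2 ⟨ENNReal.ofReal_lt_top, huTV⟩

end DataTerm

/-! ### Functions of bounded variation -/

section BV

variable {n : ℕ} {Ω : Set (EuclideanSpace ℝ (Fin n))}
  {θ₁ θ₂ u v : EuclideanSpace ℝ (Fin n) → ℝ}

lemma zero_mem_BV : (fun _ => 0) ∈ BV Ω :=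
  ⟨integrableOn_zero, by rw [totalVariation_zero]; exact ENNReal.zero_lt_top⟩

lemma add_mem_BV (hu : u ∈ BV Ω) (hv : v ∈ BV Ω) {a b : ℝ} (ha : 0 ≤ a) (hb : 0 ≤ b) :
    (fun x => a * u x + b * v x) ∈ BV Ω :=
  ⟨(hu.1.const_mul a).add (hv.1.const_mul b),
    (totalVariation_add_le hu.1 hv.1 ha hb).trans_lt
      (ENNReal.add_lt_top.2 ⟨ENNReal.mul_lt_top ENNReal.ofReal_lt_top hu.2,
        ENNReal.mul_lt_top ENNReal.ofReal_lt_top hv.2⟩)⟩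

lemma toReal_totalVariation_add_le (hu : u ∈ BV Ω) (hv : v ∈ BV Ω) {a b : ℝ} (ha : 0 ≤ a)
    (hb : 0 ≤ b) :
    (totalVariation Ω (fun x => a * u x + b * v x)).toReal ≤
      a * (totalVariation Ω u).toReal + b * (totalVariation Ω v).toReal := by
  have h := totalVariation_add_le hu.1 hv.1 ha hb
  have t1 := (ENNReal.mul_lt_top (ENNReal.ofReal_lt_top (r := a)) hu.2).ne
  have t2 := (ENNReal.mul_lt_top (ENNReal.ofReal_lt_top (r := b)) hv.2).ne
  have := ENNReal.toReal_mono (ENNReal.add_lt_top.2 ⟨t1.lt_top, t2.lt_top⟩).ne h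
  rwa [ENNReal.toReal_add t1 t2, ENNReal.toReal_mul, ENNReal.toReal_mul,
    ENNReal.toReal_ofReal ha, ENNReal.toReal_ofReal hb] at this

lemma memLp_top_of_mem_Icc (hu : IntegrableOn u Ω)
    (h : ∀ᵐ x ∂(volume.restrict Ω), 0 ≤ u x ∧ u x ≤ 1) : MemLp u ⊤ (volume.restrict Ω) :=
  memLp_top_of_bound hu.aestronglyMeasurable 1 (h.mono fun x hx => by
    rw [Real.norm_eq_abs, abs_le]; constructor <;> linarith [hx.1, hx.2])

lemma dataDensity_clamp_le {x : EuclideanSpace ℝ (Fin n)} (h₁ : 0 ≤ θ₁ x) (h₂ : 0 ≤ θ₂ x) :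
    dataDensity θ₁ θ₂ (fun y => min (max (u y) 0) 1) x ≤ dataDensity θ₁ θ₂ u x := by
  have key : ∀ r : ℝ, (min (max r 0) 1) ^ 2 ≤ r ^ 2 ∧ (1 - min (max r 0) 1) ^ 2 ≤ (1 - r) ^ 2 := by
    intro r
    rcases le_total r 0 with hr | hr
    · rw [max_eq_right hr, min_eq_left zero_le_one]
      constructor <;> nlinarith
    · rw [max_eq_left hr]
      rcases le_total r 1 with hr1 | hr1
      · rw [min_eq_left hr1]
        exact ⟨le_rfl, le_rfl⟩
      · rw [min_eq_right hr1]
        constructor <;> nlinarith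
  unfold dataDensity
  exact add_le_add (mul_le_mul_of_nonneg_right (key _).1 h₁)
    (mul_le_mul_of_nonneg_right (key _).2 h₂)

lemma lintegral_dataDensity_clamp_le (h₁ : ∀ᵐ x ∂(volume.restrict Ω), 0 ≤ θ₁ x)
    (h₂ : ∀ᵐ x ∂(volume.restrict Ω), 0 ≤ θ₂ x) :
    ∫⁻ x in Ω, ENNReal.ofReal (dataDensity θ₁ θ₂ (fun y => min (max (u y) 0) 1) x) ≤
      ∫⁻ x in Ω, ENNReal.ofReal (dataDensity θ₁ θ₂ u x) :=
  lintegral_mono_ae (by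
    filter_upwards [h₁, h₂] with x hx₁ hx₂
      using ENNReal.ofReal_le_ofReal (dataDensity_clamp_le hx₁ hx₂))

variable [IsFiniteMeasure (volume.restrict Ω)]

/-- The two parts of a function of bounded variation below and above a level `s` are of bounded
variation, and their variations add up to at most that of the function. -/
lemma split_mem_BV (hΩ : IsOpen Ω) (hu : u ∈ BV Ω) (s : ℝ) :
    (fun x => min (u x) s) ∈ BV Ω ∧ (fun x => max (u x - s) 0) ∈ BV Ω ∧
      (totalVariation Ω (fun x => min (u x) s)).toReal +
        (totalVariation Ω (fun x => max (u x - s) 0)).toReal ≤ (totalVariation Ω u).toReal := by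
  have h := totalVariation_min_add_le hΩ hu.1 s
  have h1 := (le_self_add.trans h).trans_lt hu.2
  have h2 := (le_add_self.trans h).trans_lt hu.2
  refine ⟨⟨hu.1.inf (integrable_const s), h1⟩,
    ⟨(hu.1.sub (integrable_const s)).pos_part, h2⟩, ?_⟩
  rw [← ENNReal.toReal_add h1.ne h2.ne]
  exact ENNReal.toReal_mono hu.2.ne h

/-- Truncation to `[0, 1]` does not increase the total variation. -/
lemma totalVariation_clamp_le (hΩ : IsOpen Ω) (hu : IntegrableOn u Ω) :
    totalVariation Ω (fun x => min (max (u x) 0) 1) ≤ totalVariation Ω u :=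
  (le_self_add.trans (totalVariation_min_add_le hΩ hu.pos_part 1)).trans
    (le_self_add.trans (totalVariation_posPart_add_negPart_le hΩ hu))

lemma clamp_mem_BV (hΩ : IsOpen Ω) (hu : u ∈ BV Ω) :
    (fun x => min (max (u x) 0) 1) ∈ BV Ω :=
  ⟨hu.1.pos_part.inf (integrable_const 1), (totalVariation_clamp_le hΩ hu.1).trans_lt hu.2⟩

lemma relaxedEnergy_clamp_le (hΩ : IsOpen Ω) (h₁ : ∀ᵐ x ∂(volume.restrict Ω), 0 ≤ θ₁ x)
    (h₂ : ∀ᵐ x ∂(volume.restrict Ω), 0 ≤ θ₂ x) (hu : IntegrableOn u Ω) :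
    relaxedEnergy Ω θ₁ θ₂ (fun x => min (max (u x) 0) 1) ≤ relaxedEnergy Ω θ₁ θ₂ u :=
  add_le_add (lintegral_dataDensity_clamp_le h₁ h₂) (totalVariation_clamp_le hΩ hu)

/-- Minimizers take values in `[0, 1]`, since truncation strictly lowers the data term where it
acts. -/
lemma mem_Icc_of_isMinOn (hΩ : IsOpen Ω) (hθ₁ : IntegrableOn θ₁ Ω) (hθ₂ : IntegrableOn θ₂ Ω)
    (h₁ : ∀ᵐ x ∂(volume.restrict Ω), 0 < θ₁ x) (h₂ : ∀ᵐ x ∂(volume.restrict Ω), 0 < θ₂ x)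
    (hu : u ∈ BV Ω) (hmin : IsMinOn (relaxedEnergy Ω θ₁ θ₂) (BV Ω) u) :
    ∀ᵐ x ∂(volume.restrict Ω), 0 ≤ u x ∧ u x ≤ 1 := by
  have h₁' := h₁.mono fun x hx => hx.le
  have h₂' := h₂.mono fun x hx => hx.le
  have hE := isMinOn_iff.1 hmin _ (clamp_mem_BV hΩ hu)
  have hle : ∫⁻ x in Ω, ENNReal.ofReal (dataDensity θ₁ θ₂ u x) ≤
      ∫⁻ x in Ω, ENNReal.ofReal (dataDensity θ₁ θ₂ (fun y => min (max (u y) 0) 1) x) :=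
    ENNReal.le_of_add_le_add_right hu.2.ne
      (hE.trans (add_le_add le_rfl (totalVariation_clamp_le hΩ hu.1)))
  have hfin : relaxedEnergy Ω θ₁ θ₂ u < ⊤ :=
    (isMinOn_iff.1 hmin _ zero_mem_BV).trans_lt
      (relaxedEnergy_lt_top hθ₁ hθ₂ h₁' h₂' (memLp_top_const 0) zero_mem_BV.2)
  have hDfin : ∫⁻ x in Ω, ENNReal.ofReal (dataDensity θ₁ θ₂ u x) < ⊤ :=
    lt_of_le_of_lt le_self_add hfin
  have hmeas : AEMeasurable (fun x => ENNReal.ofReal (dataDensity θ₁ θ₂ u x))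
      (volume.restrict Ω) := by
    have a := hu.1.aemeasurable
    have a' := (aemeasurable_const (b := (1 : ℝ))).sub a
    exact (((a.pow_const 2).mul hθ₁.aemeasurable).add
      ((a'.pow_const 2).mul hθ₂.aemeasurable)).ennreal_ofReal
  have heq := ae_eq_of_ae_le_of_lintegral_le (μ := volume.restrict Ω)
    (f := fun x => ENNReal.ofReal (dataDensity θ₁ θ₂ (fun y => min (max (u y) 0) 1) x))
    (g := fun x => ENNReal.ofReal (dataDensity θ₁ θ₂ u x))
    (by filter_upwards [h₁', h₂'] with x hx₁ hx₂
          using ENNReal.ofReal_le_ofReal (dataDensity_clamp_le hx₁ hx₂))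
    ((lintegral_dataDensity_clamp_le h₁' h₂').trans_lt hDfin).ne hmeas hle
  filter_upwards [heq, h₁, h₂] with x hx hx₁ hx₂
  have hx' := (ENNReal.ofReal_eq_ofReal_iff (dataDensity_nonneg hx₁.le hx₂.le _)
    (dataDensity_nonneg hx₁.le hx₂.le _)).1 hx
  simp only [dataDensity] at hx'
  constructor
  · by_contra! hneg
    rw [max_eq_right hneg.le, min_eq_left zero_le_one] at hx'
    have a1 : 0 < u x ^ 2 * θ₁ x := mul_pos (by nlinarith) hx₁
    have a2 : 0 < ((1 - u x) ^ 2 - 1) * θ₂ x := mul_pos (by nlinarith) hx₂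
    linarith
  · by_contra! hbig
    rw [max_eq_left (zero_le_one.trans hbig.le), min_eq_right hbig.le] at hx'
    have a1 : 0 < (u x ^ 2 - 1) * θ₁ x := mul_pos (by nlinarith) hx₁
    have a2 : 0 < (1 - u x) ^ 2 * θ₂ x := mul_pos (by nlinarith) hx₂
    linarith

end BV

/-! ### First-order optimality and superlevel sets -/

section Optimality

variable {n : ℕ} {Ω : Set (EuclideanSpace ℝ (Fin n))}
  {θ₁ θ₂ u v w : EuclideanSpace ℝ (Fin n) → ℝ}

/-- The first-order condition for a minimizer `u`: the negative derivative of the data term is a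
subgradient of the total variation at `u`, tested against bounded competitors. -/
lemma integral_descentDensity_le_of_isMinOn (hθ₁ : IntegrableOn θ₁ Ω) (hθ₂ : IntegrableOn θ₂ Ω)
    (h₁ : ∀ᵐ x ∂(volume.restrict Ω), 0 ≤ θ₁ x) (h₂ : ∀ᵐ x ∂(volume.restrict Ω), 0 ≤ θ₂ x)
    (hu : u ∈ BV Ω) (hub : MemLp u ⊤ (volume.restrict Ω))
    (hmin : IsMinOn (relaxedEnergy Ω θ₁ θ₂) (BV Ω) u)
    (hv : v ∈ BV Ω) (hvb : MemLp v ⊤ (volume.restrict Ω)) :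
    ∫ x in Ω, (v x - u x) * descentDensity θ₁ θ₂ u x ≤
      (totalVariation Ω v).toReal - (totalVariation Ω u).toReal := by
  set A := ∫ x in Ω, (v x - u x) * descentDensity θ₁ θ₂ u x
  set K := ∫ x in Ω, (v x - u x) ^ 2 * (θ₁ x + θ₂ x)
  have hstep : ∀ t : ℝ, 0 < t → t ≤ 1 →
      A ≤ (totalVariation Ω v).toReal - (totalVariation Ω u).toReal + t * K := by
    intro t ht ht1
    have hwBV := add_mem_BV hu hv (sub_nonneg.2 ht1) ht.le
    have hwb : MemLp (fun x => (1 - t) * u x + t * v x) ⊤ (volume.restrict Ω) :=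
      (hub.const_mul _).add (hvb.const_mul _)
    have hE := ENNReal.toReal_mono (relaxedEnergy_lt_top hθ₁ hθ₂ h₁ h₂ hwb hwBV.2).ne
      (isMinOn_iff.1 hmin _ hwBV)
    rw [toReal_relaxedEnergy hθ₁ hθ₂ h₁ h₂ hub hu.2,
      toReal_relaxedEnergy hθ₁ hθ₂ h₁ h₂ hwb hwBV.2,
      integral_dataDensity_segment hθ₁ hθ₂ hub hvb t] at hE
    have hT := toReal_totalVariation_add_le hu hv (sub_nonneg.2 ht1) ht.le
    refine le_of_mul_le_mul_left ?_ ht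
    linarith
  have hlim : Tendsto (fun k : ℕ => (totalVariation Ω v).toReal - (totalVariation Ω u).toReal +
      1 / ((k : ℝ) + 1) * K) atTop
      (𝓝 ((totalVariation Ω v).toReal - (totalVariation Ω u).toReal + 0 * K)) :=
    (tendsto_one_div_add_atTop_nhds_zero_nat.mul_const K).const_add _
  rw [zero_mul, add_zero] at hlim
  refine ge_of_tendsto' hlim fun k => hstep _ (by positivity) ?_
  rw [div_le_one (by positivity)]
  linarith [(Nat.cast_nonneg k : (0 : ℝ) ≤ k)]

/-- Since the total variation is sublinear, the subgradient inequality splits into a bound valid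
for all bounded functions and equality at the minimizer. -/
lemma dual_bounds_of_isMinOn (hθ₁ : IntegrableOn θ₁ Ω) (hθ₂ : IntegrableOn θ₂ Ω)
    (h₁ : ∀ᵐ x ∂(volume.restrict Ω), 0 ≤ θ₁ x) (h₂ : ∀ᵐ x ∂(volume.restrict Ω), 0 ≤ θ₂ x)
    (hu : u ∈ BV Ω) (hub : MemLp u ⊤ (volume.restrict Ω))
    (hmin : IsMinOn (relaxedEnergy Ω θ₁ θ₂) (BV Ω) u) :
    (totalVariation Ω u).toReal ≤ ∫ x in Ω, u x * descentDensity θ₁ θ₂ u x ∧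
    ∀ v ∈ BV Ω, MemLp v ⊤ (volume.restrict Ω) →
      ∫ x in Ω, v x * descentDensity θ₁ θ₂ u x ≤ (totalVariation Ω v).toReal := by
  constructor
  · have h := integral_descentDensity_le_of_isMinOn hθ₁ hθ₂ h₁ h₂ hu hub hmin zero_mem_BV
      (memLp_top_const 0)
    simp only [totalVariation_zero, ENNReal.toReal_zero, zero_sub, neg_mul, integral_neg] at h
    linarith
  · intro v hv hvb
    have h := integral_descentDensity_le_of_isMinOn hθ₁ hθ₂ h₁ h₂ hu hub hmin
      (add_mem_BV hu hv zero_le_one zero_le_one) ((hub.const_mul 1).add (hvb.const_mul 1))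
    have hT := toReal_totalVariation_add_le hu hv zero_le_one zero_le_one
    simp only [one_mul, add_sub_cancel_left] at h hT
    linarith

/-- The normalized slices `min ((k + 1) (t - s)⁺, 1)` of `t` converge to the indicator of
`t > s`. -/
lemma tendsto_slice (s t : ℝ) :
    Tendsto (fun k : ℕ => ((k : ℝ) + 1) * min (max (t - s) 0) (1 / ((k : ℝ) + 1))) atTop
      (𝓝 (if s < t then 1 else 0)) := by
  split_ifs with h
  · have : ∀ᶠ k : ℕ in atTop, 1 / ((k : ℝ) + 1) ≤ t - s :=
      (tendsto_one_div_add_atTop_nhds_zero_nat (𝕜 := ℝ)).eventually_le_const (sub_pos.2 h)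
    refine tendsto_const_nhds.congr' ?_
    filter_upwards [this] with k hk
    rw [max_eq_left (sub_pos.2 h).le, min_eq_right hk]
    field_simp
  · refine tendsto_const_nhds.congr fun k => ?_
    rw [max_eq_right (by linarith), min_eq_left (by positivity), mul_zero]

lemma superlevelIndicator_of_mem {s : ℝ} {x : EuclideanSpace ℝ (Fin n)} (hx : x ∈ Ω) :
    superlevelIndicator Ω u s x = if s < u x then 1 else 0 := by
  unfold superlevelIndicator
  split_ifs with h
  · exact indicator_of_mem (show x ∈ {x | x ∈ Ω ∧ s < u x} from ⟨hx, h⟩) _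
  · exact indicator_of_notMem (fun h' => h h'.2) _

/-- The superlevel indicator saturates the dual bound. By the splitting of the total variation,
each slice of `u` between two levels does, and the indicator is the limit of normalized slices. -/
lemma totalVariation_superlevelIndicator_le (hΩ : IsOpen Ω)
    [IsFiniteMeasure (volume.restrict Ω)] {g : EuclideanSpace ℝ (Fin n) → ℝ}
    (hg : IntegrableOn g Ω) (hu : u ∈ BV Ω) (hub : MemLp u ⊤ (volume.restrict Ω))
    (hug : (totalVariation Ω u).toReal ≤ ∫ x in Ω, u x * g x)
    (hvg : ∀ v ∈ BV Ω, MemLp v ⊤ (volume.restrict Ω) →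
      ∫ x in Ω, v x * g x ≤ (totalVariation Ω v).toReal) (s : ℝ) :
    AEStronglyMeasurable (superlevelIndicator Ω u s) (volume.restrict Ω) ∧
      totalVariation Ω (superlevelIndicator Ω u s) < ⊤ ∧
      (totalVariation Ω (superlevelIndicator Ω u s)).toReal ≤
        ∫ x in Ω, superlevelIndicator Ω u s x * g x := by
  set p : EuclideanSpace ℝ (Fin n) → ℝ := fun x => max (u x - s) 0 with hp
  obtain ⟨haBV, hpBV, hsum⟩ := split_mem_BV hΩ hu s
  have hab : MemLp (fun x => min (u x) s) ⊤ (volume.restrict Ω) := hub.inf (memLp_top_const s)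
  have hpb : MemLp p ⊤ (volume.restrict Ω) := (hub.sub (memLp_top_const s)).sup (memLp_top_const 0)
  let b : ℕ → EuclideanSpace ℝ (Fin n) → ℝ := fun k x => min (p x) (1 / ((k : ℝ) + 1))
  have hbb : ∀ k, MemLp (b k) ⊤ (volume.restrict Ω) := fun k => hpb.inf (memLp_top_const _)
  have hb : ∀ k, b k ∈ BV Ω ∧ (totalVariation Ω (b k)).toReal ≤ ∫ x in Ω, b k x * g x := by
    intro k
    obtain ⟨hbBV, hcBV, hsum'⟩ := split_mem_BV hΩ hpBV (1 / ((k : ℝ) + 1))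
    have hcb : MemLp (fun x => max (p x - 1 / ((k : ℝ) + 1)) 0) ⊤ (volume.restrict Ω) :=
      (hpb.sub (memLp_top_const _)).sup (memLp_top_const 0)
    refine ⟨hbBV, ?_⟩
    have ia := integrable_mul_of_memLp_top hg hab
    have ib := integrable_mul_of_memLp_top hg (hbb k)
    have ic := integrable_mul_of_memLp_top hg hcb
    have iab : IntegrableOn (fun x => min (u x) s * g x + b k x * g x) Ω := ia.add ib
    have heq : ∫ x in Ω, u x * g x = (∫ x in Ω, min (u x) s * g x) + (∫ x in Ω, b k x * g x) +
        ∫ x in Ω, max (p x - 1 / ((k : ℝ) + 1)) 0 * g x := by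
      rw [← integral_add ia ib, ← integral_add iab ic]
      refine integral_congr_ae (Eventually.of_forall fun x => ?_)
      have e : ∀ r q : ℝ, r = min r q + max (r - q) 0 := fun r q => by
        rcases le_total r q with h | h
        · simp [h]
        · simp [h]
      simp only [← add_mul]
      congr 1
      rw [add_assoc, ← e (p x) (1 / ((k : ℝ) + 1))]
      exact e (u x) s
    have ha := hvg _ haBV hab
    have hc := hvg _ hcBV hcb
    change (totalVariation Ω (fun x => min (p x) (1 / ((k : ℝ) + 1)))).toReal ≤ _
    linarith
  have hbnd : ∀ (k : ℕ) (x : EuclideanSpace ℝ (Fin n)), |((k : ℝ) + 1) * b k x| ≤ 1 := by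
    intro k x
    have h0 : 0 ≤ b k x := le_min (le_max_right _ _) (by positivity)
    rw [abs_of_nonneg (by positivity)]
    calc ((k : ℝ) + 1) * b k x ≤ ((k : ℝ) + 1) * (1 / ((k : ℝ) + 1)) := by
          gcongr; exact min_le_right _ _
      _ = 1 := by field_simp
  have hlim : ∀ᵐ x ∂(volume.restrict Ω), Tendsto (fun k : ℕ => ((k : ℝ) + 1) * b k x) atTop
      (𝓝 (superlevelIndicator Ω u s x)) := by
    filter_upwards [ae_restrict_mem hΩ.measurableSet] with x hx
    rw [superlevelIndicator_of_mem hx]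
    exact tendsto_slice s (u x)
  have hmeas : ∀ k : ℕ, AEStronglyMeasurable (fun x => ((k : ℝ) + 1) * b k x)
      (volume.restrict Ω) := fun k => (hbb k).1.const_mul _
  have hconv : ∀ {h : EuclideanSpace ℝ (Fin n) → ℝ}, IntegrableOn h Ω →
      Tendsto (fun k : ℕ => ∫ x in Ω, ((k : ℝ) + 1) * b k x * h x) atTop
        (𝓝 (∫ x in Ω, superlevelIndicator Ω u s x * h x)) := by
    intro h hh
    refine tendsto_integral_of_dominated_convergence (fun x => |h x|)
      (fun k => (hmeas k).mul hh.aestronglyMeasurable) hh.abs ?_ ?_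
    · refine fun k => Eventually.of_forall fun x => ?_
      rw [Real.norm_eq_abs, abs_mul]
      exact mul_le_of_le_one_left (abs_nonneg _) (hbnd k x)
    · filter_upwards [hlim] with x hx using hx.mul_const _
  have htest : ∀ φ ∈ tvTestFields Ω, ∫ x in Ω, superlevelIndicator Ω u s x * vectorDiv φ x ≤
      ∫ x in Ω, superlevelIndicator Ω u s x * g x := by
    intro φ hφ
    refine le_of_tendsto_of_tendsto' (hconv (integrable_vectorDiv hφ).integrableOn) (hconv hg)
      fun k => ?_
    simp only [mul_assoc]
    rw [integral_const_mul, integral_const_mul]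
    exact mul_le_mul_of_nonneg_left
      ((integral_le_toReal_totalVariation (hb k).1.2 hφ).trans (hb k).2) (by positivity)
  have hnn : 0 ≤ ∫ x in Ω, superlevelIndicator Ω u s x * g x := by
    simpa only [vectorDiv_zero, mul_zero, integral_zero] using htest _ zero_mem_tvTestFields
  have hTV := totalVariation_le_ofReal htest
  exact ⟨aestronglyMeasurable_of_tendsto_ae atTop hmeas hlim,
    hTV.trans_lt ENNReal.ofReal_lt_top, ENNReal.toReal_le_of_le_ofReal hnn hTV⟩

lemma superlevelIndicator_eq_zero_or_one (s : ℝ) (x : EuclideanSpace ℝ (Fin n)) :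
    superlevelIndicator Ω u s x = 0 ∨ superlevelIndicator Ω u s x = 1 := by
  by_cases hx : x ∈ {x | x ∈ Ω ∧ s < u x} <;> simp [superlevelIndicator, hx]

lemma memLp_top_of_binary (hu : AEStronglyMeasurable u (volume.restrict Ω))
    (h : ∀ᵐ x ∂(volume.restrict Ω), u x = 0 ∨ u x = 1) : MemLp u ⊤ (volume.restrict Ω) :=
  memLp_top_of_bound hu 1 (h.mono fun x hx => by rcases hx with hx | hx <;> simp [hx])

lemma binaryEnergy_eq (hθ₁ : IntegrableOn θ₁ Ω) (hθ₂ : IntegrableOn θ₂ Ω)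
    (h₁ : ∀ᵐ x ∂(volume.restrict Ω), 0 ≤ θ₁ x) (h₂ : ∀ᵐ x ∂(volume.restrict Ω), 0 ≤ θ₂ x)
    (hu : u ∈ BVBinary Ω) :
    IntegrableOn (fun x => θ₁ x * u x + θ₂ x * (1 - u x)) Ω ∧
    binaryEnergy Ω θ₁ θ₂ u = ENNReal.ofReal ((∫ x in Ω, θ₁ x * u x + θ₂ x * (1 - u x)) +
      (totalVariation Ω u).toReal) := by
  have hub := memLp_top_of_binary hu.1.1.aestronglyMeasurable hu.2
  have hi : IntegrableOn (fun x => θ₁ x * u x + θ₂ x * (1 - u x)) Ω :=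
    (Integrable.mul_of_top_left hθ₁ hub).add
      (Integrable.mul_of_top_left hθ₂ (memLp_top_one_sub hub))
  have hnn : 0 ≤ᵐ[volume.restrict Ω] fun x => θ₁ x * u x + θ₂ x * (1 - u x) := by
    filter_upwards [h₁, h₂, hu.2] with x hx₁ hx₂ hx
    rcases hx with hx | hx <;> simp [hx, hx₁, hx₂]
  refine ⟨hi, ?_⟩
  rw [ENNReal.ofReal_add (integral_nonneg_of_ae hnn) ENNReal.toReal_nonneg,
    ENNReal.ofReal_toReal hu.1.2.ne, ofReal_integral_eq_lintegral_ofReal hi hnn]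
  rfl

/-- The superlevel set at `1 / 2` of a minimizer solves the binary problem. Both total variations
are compared with the dual pairing against the descent density `2 (1 - u) θ₂ - 2 u θ₁`, and adding
the linear term `θ₁ - θ₂` of the binary energy leaves the weight `(1 - 2 u) (θ₁ + θ₂)`, which is
nonpositive on the superlevel set and nonnegative off it. -/
lemma superlevelIndicator_isMinOn (hΩ : IsOpen Ω) [IsFiniteMeasure (volume.restrict Ω)]
    (hθ₁ : IntegrableOn θ₁ Ω) (hθ₂ : IntegrableOn θ₂ Ω)
    (h₁ : ∀ᵐ x ∂(volume.restrict Ω), 0 ≤ θ₁ x) (h₂ : ∀ᵐ x ∂(volume.restrict Ω), 0 ≤ θ₂ x)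
    (hu : u ∈ BV Ω) (hub : MemLp u ⊤ (volume.restrict Ω))
    (hmin : IsMinOn (relaxedEnergy Ω θ₁ θ₂) (BV Ω) u) :
    superlevelIndicator Ω u (1 / 2) ∈ BVBinary Ω ∧
      IsMinOn (binaryEnergy Ω θ₁ θ₂) (BVBinary Ω) (superlevelIndicator Ω u (1 / 2)) := by
  have hg := integrableOn_descentDensity hθ₁ hθ₂ hub
  obtain ⟨hug, hvg⟩ := dual_bounds_of_isMinOn hθ₁ hθ₂ h₁ h₂ hu hub hmin
  obtain ⟨hmeas, hTV, hχ'⟩ := totalVariation_superlevelIndicator_le hΩ hg hu hub hug hvg (1 / 2)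
  have hbin : ∀ᵐ x ∂(volume.restrict Ω),
      superlevelIndicator Ω u (1 / 2) x = 0 ∨ superlevelIndicator Ω u (1 / 2) x = 1 :=
    Eventually.of_forall (superlevelIndicator_eq_zero_or_one _)
  have hχb := memLp_top_of_binary hmeas hbin
  have hχ : superlevelIndicator Ω u (1 / 2) ∈ BVBinary Ω :=
    ⟨⟨hχb.integrable le_top, hTV⟩, hbin⟩
  refine ⟨hχ, isMinOn_iff.2 fun η hη => ?_⟩
  obtain ⟨iχ, eχ⟩ := binaryEnergy_eq hθ₁ hθ₂ h₁ h₂ hχ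
  obtain ⟨iη, eη⟩ := binaryEnergy_eq hθ₁ hθ₂ h₁ h₂ hη
  have hηb := memLp_top_of_binary hη.1.1.aestronglyMeasurable hη.2
  have hη' := hvg η hη.1 hηb
  have igχ := integrable_mul_of_memLp_top hg hχb
  have igη := integrable_mul_of_memLp_top hg hηb
  rw [eχ, eη]
  refine ENNReal.ofReal_le_ofReal ?_
  have hle := integral_mono_ae (iχ.add igχ) (iη.add igη) (by
    filter_upwards [h₁, h₂, hη.2, ae_restrict_mem hΩ.measurableSet] with x hx₁ hx₂ hxη hxΩ
    simp only [Pi.add_apply, descentDensity]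
    rw [superlevelIndicator_of_mem hxΩ]
    split_ifs with h
    · have : 0 ≤ (2 * u x - 1) * (θ₁ x + θ₂ x) := mul_nonneg (by linarith) (by linarith)
      rcases hxη with hxη | hxη
      · rw [hxη]; linarith
      · rw [hxη]
    · have : 0 ≤ (1 - 2 * u x) * (θ₁ x + θ₂ x) := mul_nonneg (by linarith) (by linarith)
      rcases hxη with hxη | hxη
      · rw [hxη]
      · rw [hxη]; linarith)
  simp only [Pi.add_apply] at hle
  rw [integral_add iχ igχ, integral_add iη igη] at hle
  linarith

end Optimality

/-! ### Existence of a minimizer -/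

section Existence

variable {n : ℕ} {Ω : Set (EuclideanSpace ℝ (Fin n))}
  {θ₁ θ₂ u v : EuclideanSpace ℝ (Fin n) → ℝ}

/-- Uniform convexity of the relaxed energy: two bounded functions with energy at most `m + δ`,
where `m` is a lower bound for the energy, are close in `L²`, by comparison with their midpoint. -/
lemma integral_sq_sub_le (hθ₁ : IntegrableOn θ₁ Ω) (hθ₂ : IntegrableOn θ₂ Ω)
    {c : ℝ} (hc : 0 < c) (h₁ : ∀ᵐ x ∂(volume.restrict Ω), c ≤ θ₁ x)
    (h₂ : ∀ᵐ x ∂(volume.restrict Ω), c ≤ θ₂ x) [IsFiniteMeasure (volume.restrict Ω)]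
    (hu : u ∈ BV Ω) (hub : MemLp u ⊤ (volume.restrict Ω))
    (hv : v ∈ BV Ω) (hvb : MemLp v ⊤ (volume.restrict Ω)) {m δ : ℝ}
    (hm : ∀ w ∈ BV Ω, MemLp w ⊤ (volume.restrict Ω) → m ≤ (relaxedEnergy Ω θ₁ θ₂ w).toReal)
    (huE : (relaxedEnergy Ω θ₁ θ₂ u).toReal ≤ m + δ)
    (hvE : (relaxedEnergy Ω θ₁ θ₂ v).toReal ≤ m + δ) :
    c / 2 * ∫ x in Ω, (v x - u x) ^ 2 ≤ δ := by
  have h₁' := h₁.mono fun x hx => hc.le.trans hx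
  have h₂' := h₂.mono fun x hx => hc.le.trans hx
  have hw := add_mem_BV hu hv (a := 1 - 1 / 2) (b := 1 / 2) (by norm_num) (by norm_num)
  have hwb : MemLp (fun x => (1 - 1 / 2) * u x + 1 / 2 * v x) ⊤ (volume.restrict Ω) :=
    (hub.const_mul _).add (hvb.const_mul _)
  have hmid := hm _ hw hwb
  have hT := toReal_totalVariation_add_le hu hv (a := 1 - 1 / 2) (b := 1 / 2) (by norm_num)
    (by norm_num)
  rw [toReal_relaxedEnergy hθ₁ hθ₂ h₁' h₂' hwb hw.2,
    integral_dataDensity_segment hθ₁ hθ₂ hub hvb] at hmid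
  rw [toReal_relaxedEnergy hθ₁ hθ₂ h₁' h₂' hub hu.2] at huE
  have hend := integral_dataDensity_segment hθ₁ hθ₂ hub hvb 1
  simp only [sub_self, zero_mul, zero_add, one_mul, one_pow] at hend
  rw [toReal_relaxedEnergy hθ₁ hθ₂ h₁' h₂' hvb hv.2,
    show ∫ x in Ω, dataDensity θ₁ θ₂ v x = _ from hend] at hvE
  have hK : 2 * c * ∫ x in Ω, (v x - u x) ^ 2 ≤
      ∫ x in Ω, (v x - u x) ^ 2 * (θ₁ x + θ₂ x) := by
    have hsq := memLp_top_pow_two (hvb.sub hub)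
    rw [← integral_const_mul]
    refine integral_mono_ae ((hsq.integrable le_top).const_mul _)
      (integrable_mul_of_memLp_top (hθ₁.add hθ₂) hsq) ?_
    filter_upwards [h₁, h₂] with x hx₁ hx₂
    nlinarith [sq_nonneg (v x - u x)]
  linarith

/-- A bounded sequence whose tails have geometrically small `L²` diameter converges almost
everywhere to a measurable limit. -/
lemma exists_ae_limit_of_integral_sq_sub_le [IsFiniteMeasure (volume.restrict Ω)]
    {f : ℕ → EuclideanSpace ℝ (Fin n) → ℝ} (hf : ∀ k, MemLp (f k) ⊤ (volume.restrict Ω))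
    (hcau : ∀ N k l, N ≤ k → N ≤ l → ∫ x in Ω, (f k x - f l x) ^ 2 ≤ (1 / 4 : ℝ) ^ (N + 1)) :
    ∃ u : EuclideanSpace ℝ (Fin n) → ℝ, AEStronglyMeasurable u (volume.restrict Ω) ∧
      ∀ᵐ x ∂(volume.restrict Ω), Tendsto (fun k => f k x) atTop (𝓝 (u x)) := by
  have hae := Lp.ae_tendsto_of_cauchy_eLpNorm' (μ := volume.restrict Ω) (p := 2)
    (B := fun N => ENNReal.ofReal ((1 / 2 : ℝ) ^ N)) (fun k => (hf k).1) one_le_two ?_ ?_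
  · refine ⟨fun x => limUnder atTop fun k => f k x, ?_, ?_⟩
    · exact aestronglyMeasurable_of_tendsto_ae atTop (fun k => (hf k).1)
        (hae.mono fun x hx => tendsto_nhds_limUnder hx)
    · exact hae.mono fun x hx => tendsto_nhds_limUnder hx
  · rw [← ENNReal.ofReal_tsum_of_nonneg (fun k => by positivity)
      (summable_geometric_of_lt_one (by norm_num) (by norm_num))]
    exact ENNReal.ofReal_ne_top
  · intro N k l hk hl
    have hi : IntegrableOn (fun x => (f k x - f l x) ^ 2) Ω :=
      (memLp_top_pow_two ((hf k).sub (hf l))).integrable le_top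
    have h1 : ∫⁻ x in Ω, ‖(f k - f l) x‖ₑ ^ (2 : ℝ) =
        ENNReal.ofReal (∫ x in Ω, (f k x - f l x) ^ 2) := by
      rw [ofReal_integral_eq_lintegral_ofReal hi (Eventually.of_forall fun x => sq_nonneg _)]
      refine lintegral_congr fun x => ?_
      rw [Pi.sub_apply, ← ofReal_norm, ENNReal.ofReal_rpow_of_nonneg (norm_nonneg _)
        zero_le_two, Real.rpow_two, Real.norm_eq_abs, sq_abs]
    rw [eLpNorm'_eq_lintegral_enorm, h1]
    calc ENNReal.ofReal (∫ x in Ω, (f k x - f l x) ^ 2) ^ (1 / (2 : ℝ))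
        ≤ ENNReal.ofReal ((1 / 4 : ℝ) ^ (N + 1)) ^ (1 / (2 : ℝ)) := by
          gcongr
          exact hcau N k l hk hl
      _ = ENNReal.ofReal ((1 / 2 : ℝ) ^ (N + 1)) := by
          rw [ENNReal.ofReal_rpow_of_nonneg (by positivity) (by norm_num), ← Real.sqrt_eq_rpow,
            show (1 / 4 : ℝ) ^ (N + 1) = ((1 / 2) ^ (N + 1)) ^ 2 by
              rw [← pow_mul, mul_comm, pow_mul]; norm_num,
            Real.sqrt_sq (by positivity)]
      _ < ENNReal.ofReal ((1 / 2 : ℝ) ^ N) := by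
          rw [ENNReal.ofReal_lt_ofReal_iff (by positivity), pow_succ]
          have : (0 : ℝ) < (1 / 2) ^ N := by positivity
          linarith

/-- The direct method. Truncation and uniform convexity make a fast minimizing sequence converge
almost everywhere, so no weak compactness is needed. -/
lemma exists_isMinOn_relaxedEnergy (hΩ : IsOpen Ω) (hθ₁ : IntegrableOn θ₁ Ω)
    (hθ₂ : IntegrableOn θ₂ Ω) {c : ℝ} (hc : 0 < c)
    (h₁ : ∀ᵐ x ∂(volume.restrict Ω), c ≤ θ₁ x)
    (h₂ : ∀ᵐ x ∂(volume.restrict Ω), c ≤ θ₂ x) [IsFiniteMeasure (volume.restrict Ω)] :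
    ∃ u ∈ BV Ω, IsMinOn (relaxedEnergy Ω θ₁ θ₂) (BV Ω) u := by
  have h₁' := h₁.mono fun x hx => hc.le.trans hx
  have h₂' := h₂.mono fun x hx => hc.le.trans hx
  set m : ℝ≥0∞ := ⨅ w ∈ BV Ω, relaxedEnergy Ω θ₁ θ₂ w with hmdef
  have hmle : ∀ w ∈ BV Ω, m ≤ relaxedEnergy Ω θ₁ θ₂ w := fun w hw => iInf₂_le w hw
  have hmfin : m < ⊤ := (hmle _ zero_mem_BV).trans_lt
    (relaxedEnergy_lt_top hθ₁ hθ₂ h₁' h₂' (memLp_top_const 0) zero_mem_BV.2)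
  -- the rate is chosen so that the `L²` distances of the minimizing sequence are summable
  let δ : ℕ → ℝ := fun k => c / 2 * (1 / 4) ^ (k + 1)
  have hδpos : ∀ k, 0 < δ k := fun k => by positivity
  have hδanti : ∀ {N k : ℕ}, N ≤ k → δ k ≤ δ N := fun {N k} h =>
    mul_le_mul_of_nonneg_left
      (pow_le_pow_of_le_one (by norm_num) (by norm_num) (by omega)) (by positivity)
  have hex : ∀ k, ∃ w ∈ BV Ω, (∀ x, 0 ≤ w x ∧ w x ≤ 1) ∧
      relaxedEnergy Ω θ₁ θ₂ w ≤ m + ENNReal.ofReal (δ k) := by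
    intro k
    have hlt : m < m + ENNReal.ofReal (δ k) :=
      ENNReal.lt_add_right hmfin.ne (ENNReal.ofReal_pos.2 (hδpos k)).ne'
    obtain ⟨w, hw⟩ := iInf_lt_iff.1 hlt
    obtain ⟨hwBV, hwE⟩ := iInf_lt_iff.1 hw
    exact ⟨_, clamp_mem_BV hΩ hwBV,
      fun x => ⟨le_min (le_max_right _ _) zero_le_one, min_le_right _ _⟩,
      (relaxedEnergy_clamp_le hΩ h₁' h₂' hwBV.1).trans hwE.le⟩
  choose f hfBV hf01 hfE using hex
  have hfb : ∀ k, MemLp (f k) ⊤ (volume.restrict Ω) := fun k =>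
    memLp_top_of_mem_Icc (hfBV k).1 (Eventually.of_forall (hf01 k))
  have hmreal : ∀ w ∈ BV Ω, MemLp w ⊤ (volume.restrict Ω) →
      m.toReal ≤ (relaxedEnergy Ω θ₁ θ₂ w).toReal := fun w hw hwb =>
    ENNReal.toReal_mono (relaxedEnergy_lt_top hθ₁ hθ₂ h₁' h₂' hwb hw.2).ne (hmle w hw)
  have hfE' : ∀ {N k : ℕ}, N ≤ k → (relaxedEnergy Ω θ₁ θ₂ (f k)).toReal ≤ m.toReal + δ N := by
    intro N k h
    have := ENNReal.toReal_mono (ENNReal.add_lt_top.2 ⟨hmfin, ENNReal.ofReal_lt_top⟩).ne (hfE k)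
    rw [ENNReal.toReal_add hmfin.ne ENNReal.ofReal_ne_top,
      ENNReal.toReal_ofReal (hδpos k).le] at this
    linarith [hδanti h]
  obtain ⟨u, hum, hlim⟩ := exists_ae_limit_of_integral_sq_sub_le hfb fun N k l hk hl => by
    refine le_of_mul_le_mul_left ?_ (half_pos hc)
    exact integral_sq_sub_le hθ₁ hθ₂ hc h₁ h₂ (hfBV l) (hfb l) (hfBV k) (hfb k) hmreal
      (hfE' hl) (hfE' hk)
  have hu01 : ∀ᵐ x ∂(volume.restrict Ω), 0 ≤ u x ∧ u x ≤ 1 := by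
    filter_upwards [hlim] with x hx
    exact ⟨ge_of_tendsto' hx fun k => (hf01 k x).1, le_of_tendsto' hx fun k => (hf01 k x).2⟩
  have hub : MemLp u ⊤ (volume.restrict Ω) :=
    memLp_top_of_bound hum 1 (hu01.mono fun x hx => by
      rw [Real.norm_eq_abs, abs_le]; constructor <;> linarith [hx.1, hx.2])
  have hD : Tendsto (fun k => ∫ x in Ω, dataDensity θ₁ θ₂ (f k) x) atTop
      (𝓝 (∫ x in Ω, dataDensity θ₁ θ₂ u x)) := by
    refine tendsto_integral_of_dominated_convergence (fun x => θ₁ x + θ₂ x)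
      (fun k => (integrableOn_dataDensity hθ₁ hθ₂ (hfb k)).aestronglyMeasurable)
      (hθ₁.add hθ₂) (fun k => ?_) ?_
    · filter_upwards [h₁', h₂'] with x hx₁ hx₂
      obtain ⟨a, b⟩ := hf01 k x
      rw [Real.norm_of_nonneg (dataDensity_nonneg hx₁ hx₂ _)]
      exact add_le_add (mul_le_of_le_one_left hx₁ (by nlinarith))
        (mul_le_of_le_one_left hx₂ (by nlinarith))
    · filter_upwards [hlim] with x hx
      exact ((hx.pow 2).mul_const _).add (((tendsto_const_nhds.sub hx).pow 2).mul_const _)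
  have hδ0 : Tendsto (fun k => m.toReal + δ k) atTop (𝓝 m.toReal) := by
    have h := (((tendsto_pow_atTop_nhds_zero_of_lt_one (r := (1 / 4 : ℝ)) (by norm_num)
      (by norm_num)).comp (tendsto_add_atTop_nat 1)).const_mul (c / 2)).const_add m.toReal
    rwa [mul_zero, add_zero] at h
  have hreal : ∀ k, (∫ x in Ω, dataDensity θ₁ θ₂ (f k) x) + (totalVariation Ω (f k)).toReal ≤
      m.toReal + δ k := fun k => by
    rw [← toReal_relaxedEnergy hθ₁ hθ₂ h₁' h₂' (hfb k) (hfBV k).2]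
    exact hfE' le_rfl
  have hTV : totalVariation Ω u ≤
      ENNReal.ofReal (m.toReal - ∫ x in Ω, dataDensity θ₁ θ₂ u x) := by
    refine totalVariation_le_of_tendsto (w := f) ?_
      ((ENNReal.continuous_ofReal.tendsto _).comp (hδ0.sub hD)) fun k => ?_
    · intro φ hφ
      refine tendsto_integral_of_dominated_convergence (fun x => |vectorDiv φ x|)
        (fun k => (integrableOn_mul_vectorDiv (hfBV k).1 hφ).aestronglyMeasurable)
        (integrable_vectorDiv hφ).abs.integrableOn (fun k => Eventually.of_forall fun x => ?_) ?_
      · rw [Real.norm_eq_abs, abs_mul, abs_of_nonneg (hf01 k x).1]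
        exact mul_le_of_le_one_left (abs_nonneg _) (hf01 k x).2
      · filter_upwards [hlim] with x hx using hx.mul_const _
    · rw [← ENNReal.ofReal_toReal (hfBV k).2.ne]
      refine ENNReal.ofReal_le_ofReal ?_
      linarith [hreal k]
  refine ⟨u, ⟨hub.integrable le_top, hTV.trans_lt ENNReal.ofReal_lt_top⟩,
    isMinOn_iff.2 fun w hw => le_trans ?_ (hmle w hw)⟩
  have hDm : ∫ x in Ω, dataDensity θ₁ θ₂ u x ≤ m.toReal :=
    le_of_tendsto_of_tendsto' hD hδ0 fun k => by
      linarith [hreal k, ENNReal.toReal_nonneg (a := totalVariation Ω (f k))]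
  rw [relaxedEnergy_eq hθ₁ hθ₂ h₁' h₂' hub]
  refine (add_le_add le_rfl hTV).trans ?_
  rw [← ENNReal.ofReal_add (integral_dataDensity_nonneg h₁' h₂') (sub_nonneg.2 hDm),
    add_sub_cancel, ENNReal.ofReal_toReal hmfin.ne]

/-- A positive lower bound for an integrable function forces the domain to have finite measure. -/
lemma isFiniteMeasure_of_le_integrable {θ : EuclideanSpace ℝ (Fin n) → ℝ}
    (hθ : IntegrableOn θ Ω) {c : ℝ} (hc : 0 < c)
    (h : ∀ᵐ x ∂(volume.restrict Ω), c ≤ θ x) : IsFiniteMeasure (volume.restrict Ω) := by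
  have hi : Integrable (fun _ : EuclideanSpace ℝ (Fin n) => c) (volume.restrict Ω) :=
    Integrable.mono hθ aestronglyMeasurable_const (h.mono fun x hx => by
      rw [Real.norm_of_nonneg hc.le, Real.norm_of_nonneg (hc.le.trans hx)]
      exact hx)
  exact (integrable_const_iff.1 hi).resolve_left hc.ne'

end Existence

theorem proposition1 (n : ℕ) (Ω : Set (EuclideanSpace ℝ (Fin n))) (hΩ : IsOpen Ω)
    (θ₁ θ₂ : EuclideanSpace ℝ (Fin n) → ℝ)
    (hθ₁ : IntegrableOn θ₁ Ω) (hθ₂ : IntegrableOn θ₂ Ω)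
    (c : ℝ) (hc : 0 < c)
    (hcθ₁ : ∀ᵐ x ∂(volume.restrict Ω), c ≤ θ₁ x)
    (hcθ₂ : ∀ᵐ x ∂(volume.restrict Ω), c ≤ θ₂ x) :
    (∃ u ∈ BV Ω, IsMinOn (relaxedEnergy Ω θ₁ θ₂) (BV Ω) u) ∧
    ∀ u ∈ BV Ω, IsMinOn (relaxedEnergy Ω θ₁ θ₂) (BV Ω) u →
      (∀ᵐ x ∂(volume.restrict Ω), 0 ≤ u x ∧ u x ≤ 1) ∧
      superlevelIndicator Ω u (1 / 2) ∈ BVBinary Ω ∧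
      IsMinOn (binaryEnergy Ω θ₁ θ₂) (BVBinary Ω) (superlevelIndicator Ω u (1 / 2)) := by
  have := isFiniteMeasure_of_le_integrable hθ₁ hc hcθ₁
  have h₁ : ∀ᵐ x ∂(volume.restrict Ω), 0 < θ₁ x := hcθ₁.mono fun x hx => hc.trans_le hx
  have h₂ : ∀ᵐ x ∂(volume.restrict Ω), 0 < θ₂ x := hcθ₂.mono fun x hx => hc.trans_le hx
  refine ⟨exists_isMinOn_relaxedEnergy hΩ hθ₁ hθ₂ hc hcθ₁ hcθ₂, fun u hu hmin => ?_⟩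
  have h01 := mem_Icc_of_isMinOn hΩ hθ₁ hθ₂ h₁ h₂ hu hmin
  exact ⟨h01, superlevelIndicator_isMinOn hΩ hθ₁ hθ₂ (h₁.mono fun x hx => hx.le)
    (h₂.mono fun x hx => hx.le) hu (memLp_top_of_mem_Icc hu.1 h01) hmin⟩
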